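/- Let $\Omega$ be a finite set of states with a full-support prior $p\in\Delta(\Omega)$, let $A$ be a nonempty compact metric space, and let the sender's state-independent utility $u_S:A\to\mathbb R$ and the receiver's utility $u_R:\Omega\times A\to\mathbb R$ be continuous. For $\mu\in\Delta(\Omega)$ put $\mathbf V(\mu)=\mathrm{co}\big(u_S(\arg\max_{a\in A}\mathbb E_\mu[u_R(\omega,a)])\big)$, $\overline V(\mu)=\max\mathbf V(\mu)$, $\underline V(\mu)=\min\mathbf V(\mu)$. Let $\overline V_{CT}$ be the pointwise infimum of all quasiconcave functions on $\Delta(\Omega)$ that majorize $\overline V$, and $\underline V_{CT}$ the pointwise supremum of all quasiconvex functions on $\Delta(\Omega)$ that are majorized by $\underline V$. Write $V\in\mathbf V$ for a measurable selection, and call $\tau\in\Delta(\Delta(\Omega))$ Bayes plausible if $\int\mu\,d\tau(\mu)=p$. Mediation: $\mathcal V_{MD}(p)$ is the supremum of $\int V\,d\tau$ over all $V\in\mathbf V$ and Bayes plausible $\tau$ with $\mathrm{Cov}_\tau[V(\mu),\mu(\omega)]=0$ for all $\omega\in\Omega$; $\tau$ is optimal under mediation if it attains this supremum with some such $V$. Cheap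 talk: $\mathcal V_{CT}(p)$ is the supremum of $\int V\,d\tau$ over all $V\in\mathbf V$ and Bayes plausible $\tau$ such that $V$ is constant on $\mathrm{supp}(\tau)$; the set of these $\tau$ is $\mathcal T_{CT}(p)$, and $\tau\in\mathcal T_{CT}(p)$ attains the value $s$ if $s\in\bigcap_{\mu\in\mathrm{supp}(\tau)}\mathbf V(\mu)$. Let $H^*$ be the union of the sets $\mathrm{aff}(\mathrm{supp}(\tau))\cap\Delta(\Omega)$ over all $\tau\in\mathcal T_{CT}(p)$ with finite support that attain the value $\mathcal V_{CT}(p)$. Cheap talk is improvable (locally improvable) at $p$ if there are $\mu\in\Delta(\Omega)$ ($\mu\in H^*$) and $\lambda\in[0,1)$ with $$\overline V_{CT}(\lambda\mu+(1-\lambda)p)>\mathcal V_{CT}(p)>\underline V_{CT}(\mu).$$ A communication mechanism is a family $\sigma=(\sigma_\omega)_{\omega\in\Omega}$ of probability distributions on a measurable space $M$ of messages. A (truthful) communication equilibrium of $\sigma$ consists of the receiver's posterior beliefs, given by Bayes' rule from $p$, $\sigma$ and the message, and of a mixed action of the receiver after each message such that the receiver best responds to the posterior after almost every message and the sender gains in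 no state $\omega$ from the report of another state $\omega'$ (which replaces $\sigma_\omega$ by $\sigma_{\omega'}$). The mechanism, with this equilibrium, induces the distribution $\tau$ of the receiver's posterior beliefs. The mechanism is random if $\sigma_\omega$ is non-degenerate for some $\omega$, that is, some event has probability strictly between $0$ and $1$ under $\sigma_\omega$. The following hold. 1. If cheap talk is locally improvable at $p$, then $\mathcal V_{MD}(p)>\mathcal V_{CT}(p)$, and every optimal distribution of beliefs under mediation is induced by a random communication mechanism, in an equilibrium that gives the sender the expected payoff $\mathcal V_{MD}(p)$, and is not induced by any mechanism that is not random. 2. If cheap talk is not improvable at $p$, then $\mathcal V_{MD}(p)=\mathcal V_{CT}(p)$. 3. If the full-dimensionality condition $H^*=\Delta(\Omega)$ holds at $p$, then $\mathcal V_{MD}(p)>\mathcal V_{CT}(p)$ if and only if cheap talk is improvable at $p$. -/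

import Mathlib

open MeasureTheory ProbabilityTheory Set

namespace Mediation

universe u v w

noncomputable section

/-- The set of beliefs `Δ(Ω)` over a finite state space, as a type. -/
abbrev Belief (Ω : Type u) [Fintype Ω] : Type u := stdSimplex ℝ Ω

section Payoffs

variable {Ω : Type u} [Fintype Ω] {A : Type v}

/-- The receiver's best responses `argmax_a E_μ[u_R(ω, a)]` at the belief `μ`. -/
def bestResponses (uR : Ω → A → ℝ) (μ : Ω → ℝ) : Set A :=
  {a | ∀ a' : A, ∑ ω, μ ω * uR ω a' ≤ ∑ ω, μ ω * uR ω a}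

/-- The sender's indirect value correspondence `𝐕(μ) = co (u_S (argmax_a E_μ[u_R(ω, a)]))`. -/
def valueCorr (uS : A → ℝ) (uR : Ω → A → ℝ) (μ : Ω → ℝ) : Set ℝ :=
  convexHull ℝ (uS '' bestResponses uR μ)

/-- The upper envelope `max 𝐕(μ)`. -/
def upperValue (uS : A → ℝ) (uR : Ω → A → ℝ) (μ : Ω → ℝ) : ℝ :=
  sSup (valueCorr uS uR μ)

/-- The lower envelope `min 𝐕(μ)`. -/
def lowerValue (uS : A → ℝ) (uR : Ω → A → ℝ) (μ : Ω → ℝ) : ℝ :=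
  sInf (valueCorr uS uR μ)

/-- The quasiconcave envelope of `𝐕`: the pointwise infimum over all quasiconcave functions on
`Δ(Ω)` that majorize `max 𝐕`. (Only its values at points of `Δ(Ω)` are meaningful.) -/
def quasiconcaveEnvelope (uS : A → ℝ) (uR : Ω → A → ℝ) (μ : Ω → ℝ) : ℝ :=
  sInf {x | ∃ f : (Ω → ℝ) → ℝ, QuasiconcaveOn ℝ (stdSimplex ℝ Ω) f ∧
    (∀ ν ∈ stdSimplex ℝ Ω, upperValue uS uR ν ≤ f ν) ∧ x = f μ}

/-- The quasiconvex envelope of `𝐕`: the pointwise supremum over all quasiconvex functions on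
`Δ(Ω)` that are majorized by `min 𝐕`. (Only its values at points of `Δ(Ω)` are meaningful.) -/
def quasiconvexEnvelope (uS : A → ℝ) (uR : Ω → A → ℝ) (μ : Ω → ℝ) : ℝ :=
  sSup {x | ∃ f : (Ω → ℝ) → ℝ, QuasiconvexOn ℝ (stdSimplex ℝ Ω) f ∧
    (∀ ν ∈ stdSimplex ℝ Ω, f ν ≤ lowerValue uS uR ν) ∧ x = f μ}

/-- `V` is a measurable selection from `𝐕`. -/
def IsSelection (uS : A → ℝ) (uR : Ω → A → ℝ) (V : Belief Ω → ℝ) : Prop :=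
  Measurable V ∧ ∀ μ : Belief Ω, V μ ∈ valueCorr uS uR μ

/-- Bayes plausibility: the mean of the distribution of beliefs `τ` is the prior `p`. -/
def BayesPlausible (p : Ω → ℝ) (τ : ProbabilityMeasure (Belief Ω)) : Prop :=
  ∀ ω, ∫ μ : Belief Ω, μ.1 ω ∂(τ : Measure (Belief Ω)) = p ω

/-! ### Mediation -/

/-- `(τ, V)` is feasible in the mediation program at the prior `p`: `V` is a measurable selection,
`τ` is Bayes plausible and the covariance under `τ` of `V(μ)` with every `μ(ω)` vanishes. -/
def MDFeasible (uS : A → ℝ) (uR : Ω → A → ℝ) (p : Ω → ℝ) (τ : ProbabilityMeasure (Belief Ω))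
    (V : Belief Ω → ℝ) : Prop :=
  IsSelection uS uR V ∧ BayesPlausible p τ ∧
    ∀ ω, covariance V (fun μ : Belief Ω => μ.1 ω) (τ : Measure (Belief Ω)) = 0

/-- The sender's optimal value under mediation. -/
def valueMD (uS : A → ℝ) (uR : Ω → A → ℝ) (p : Ω → ℝ) : ℝ :=
  sSup {x | ∃ τ V, MDFeasible uS uR p τ V ∧ x = ∫ μ, V μ ∂(τ : Measure (Belief Ω))}

/-- `τ` is an optimal distribution of beliefs under mediation at the prior `p`. -/
def IsOptimalMD (uS : A → ℝ) (uR : Ω → A → ℝ) (p : Ω → ℝ)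
    (τ : ProbabilityMeasure (Belief Ω)) : Prop :=
  ∃ V, MDFeasible uS uR p τ V ∧ ∫ μ, V μ ∂(τ : Measure (Belief Ω)) = valueMD uS uR p

/-! ### Cheap talk -/

/-- `(τ, V)` is feasible in the cheap talk program at the prior `p`: `V` is a measurable selection
that is constant on the support of the Bayes plausible distribution `τ`. -/
def CTFeasible (uS : A → ℝ) (uR : Ω → A → ℝ) (p : Ω → ℝ) (τ : ProbabilityMeasure (Belief Ω))
    (V : Belief Ω → ℝ) : Prop :=
  IsSelection uS uR V ∧ BayesPlausible p τ ∧
    ∃ c : ℝ, ∀ μ ∈ (τ : Measure (Belief Ω)).support, V μ = c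

/-- The value of the sender's preferred cheap talk equilibrium. -/
def valueCT (uS : A → ℝ) (uR : Ω → A → ℝ) (p : Ω → ℝ) : ℝ :=
  sSup {x | ∃ τ V, CTFeasible uS uR p τ V ∧ x = ∫ μ, V μ ∂(τ : Measure (Belief Ω))}

/-- `τ` is implementable under cheap talk at the prior `p` and attains the value `s` there, that
is, `s` belongs to `𝐕(μ)` for all `μ` in the support of `τ`. -/
def AttainsCT (uS : A → ℝ) (uR : Ω → A → ℝ) (p : Ω → ℝ) (τ : ProbabilityMeasure (Belief Ω))
    (s : ℝ) : Prop :=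
  (∃ V, CTFeasible uS uR p τ V) ∧
    ∀ μ ∈ (τ : Measure (Belief Ω)).support, s ∈ valueCorr uS uR μ

/-- The cheap talk hull `H(s)` at the prior `p`: the union of the sets `aff (supp τ) ∩ Δ(Ω)` over
the finitely supported cheap talk distributions `τ` that attain the value `s`. -/
def cheapTalkHull (uS : A → ℝ) (uR : Ω → A → ℝ) (p : Ω → ℝ) (s : ℝ) : Set (Ω → ℝ) :=
  {μ | μ ∈ stdSimplex ℝ Ω ∧ ∃ τ : ProbabilityMeasure (Belief Ω), AttainsCT uS uR p τ s ∧
    (τ : Measure (Belief Ω)).support.Finite ∧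
    μ ∈ affineSpan ℝ (Subtype.val '' (τ : Measure (Belief Ω)).support)}

/-- The full-dimensionality condition at `p`: the hull `H* = H(V_CT(p))` is all of `Δ(Ω)`. -/
def FullDimensional (uS : A → ℝ) (uR : Ω → A → ℝ) (p : Ω → ℝ) : Prop :=
  cheapTalkHull uS uR p (valueCT uS uR p) = stdSimplex ℝ Ω

/-- The value `s` can be improved at `p` in the direction of a belief in the set `D`. -/
def ImprovableToward (uS : A → ℝ) (uR : Ω → A → ℝ) (p : Ω → ℝ) (s : ℝ) (D : Set (Ω → ℝ)) : Prop :=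
  ∃ μ ∈ D, ∃ r ∈ Ico (0 : ℝ) 1,
    s < quasiconcaveEnvelope uS uR (r • μ + (1 - r) • p) ∧ quasiconvexEnvelope uS uR μ < s

/-- Cheap talk is improvable at `p`. -/
def CTImprovable (uS : A → ℝ) (uR : Ω → A → ℝ) (p : Ω → ℝ) : Prop :=
  ImprovableToward uS uR p (valueCT uS uR p) (stdSimplex ℝ Ω)

/-- Cheap talk is locally improvable at `p`. -/
def CTLocallyImprovable (uS : A → ℝ) (uR : Ω → A → ℝ) (p : Ω → ℝ) : Prop :=
  ImprovableToward uS uR p (valueCT uS uR p) (cheapTalkHull uS uR p (valueCT uS uR p))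

end Payoffs

section Mechanisms

/-! ### Communication mechanisms -/

variable {Ω : Type u} [Fintype Ω] {A : Type v} [MeasurableSpace A]
  {M : Type w} [MeasurableSpace M]

/-- The unconditional law of the message when the state is drawn from `p` and the message from
`σ ω`. -/
def messageLaw (p : Ω → ℝ) (σ : Ω → ProbabilityMeasure M) : Measure M :=
  ∑ ω, ENNReal.ofReal (p ω) • (σ ω : Measure M)

/-- A truthful communication equilibrium of the mechanism `σ : Ω → Δ(M)`, in which the sender
reports the state to the mediator. The receiver holds the belief `β m` and plays the mixed action
`α m` after the message `m`. -/
structure IsCommunicationEquilibrium (uS : A → ℝ) (uR : Ω → A → ℝ) (p : Ω → ℝ)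
    (σ : Ω → ProbabilityMeasure M) (α : Kernel M A) (β : M → Belief Ω) : Prop where
  /-- The receiver's strategy is a map to probability distributions over actions. -/
  markov : IsMarkovKernel α
  measurable_belief : Measurable β
  /-- Bayes' rule: `β` is a version of the conditional probability of the state given the
  message. -/
  bayes : ∀ ω, ENNReal.ofReal (p ω) • (σ ω : Measure M) =
    (messageLaw p σ).withDensity fun m => ENNReal.ofReal ((β m).1 ω)
  /-- The receiver best responds to the belief after almost every message. -/
  obedience : ∀ᵐ m ∂(messageLaw p σ), ∀ᵐ a ∂(α m), a ∈ bestResponses uR (β m)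
  /-- The sender does not gain from misreporting the state. -/
  honesty : ∀ ω ω', ∫ m, ∫ a, uS a ∂(α m) ∂(σ ω' : Measure M) ≤
    ∫ m, ∫ a, uS a ∂(α m) ∂(σ ω : Measure M)

/-- The distribution of the receiver's beliefs in the equilibrium is `τ`. -/
def Induces (p : Ω → ℝ) (σ : Ω → ProbabilityMeasure M) (β : M → Belief Ω)
    (τ : ProbabilityMeasure (Belief Ω)) : Prop :=
  (messageLaw p σ).map β = (τ : Measure (Belief Ω))

/-- The sender's ex ante expected payoff. -/
def senderPayoff (uS : A → ℝ) (p : Ω → ℝ) (σ : Ω → ProbabilityMeasure M) (α : Kernel M A) : ℝ :=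
  ∫ m, ∫ a, uS a ∂(α m) ∂(messageLaw p σ)

/-- The mechanism is random: for some state the law of the message is non-degenerate, i.e. some
event has conditional probability strictly between `0` and `1`. -/
def IsRandom (σ : Ω → ProbabilityMeasure M) : Prop :=
  ∃ ω, ∃ B : Set M, MeasurableSet B ∧
    0 < (σ ω : Measure M) B ∧ (σ ω : Measure M) B < 1

end Mechanisms

/-- `τ` is induced by a communication equilibrium of some random communication mechanism that
gives the sender the payoff `x`. -/
def InducedByRandomMechanism {Ω : Type u} [Fintype Ω] {A : Type v} [MeasurableSpace A]
    (uS : A → ℝ) (uR : Ω → A → ℝ) (p : Ω → ℝ) (τ : ProbabilityMeasure (Belief Ω)) (x : ℝ) : Prop :=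
  ∃ (M : Type u) (_ : MeasurableSpace M) (σ : Ω → ProbabilityMeasure M) (α : Kernel M A)
    (β : M → Belief Ω), IsCommunicationEquilibrium uS uR p σ α β ∧ Induces p σ β τ ∧
      senderPayoff uS p σ α = x ∧ IsRandom σ

end

end Mediation

open Mediation

namespace Mediation

/-! Under Bayes plausibility, zero covariance means `∫ V μ dτ = (∫ V dτ) p`. After reduction to
finitely many beliefs, `v` is a mediation value iff `(p, v p)` is a convex combination of points
`(μ, c μ)` with `c ∈ 𝐕(μ)` (`MDFeasible.mem_convexHull`, `exists_mdFeasible_of_mem_convexHull`).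
Similarly, `v` is a cheap talk value as soon as `p` splits into finitely many beliefs at which `v`
is available. Write `s` for the cheap talk value.

Improvability is necessary (`ctImprovable_of_valueCT_lt_valueMD`): if weights `wᵢ`, beliefs `qᵢ` and
values `cᵢ` mediate `v > s`, then `∑ wᵢ (cᵢ - s) qᵢ = (v - s) p`. Normalizing the positive and the
negative terms gives beliefs `x₊` and `x₋` such that `x₊` lies between `p` and `x₋`, the
quasiconcave envelope exceeds `s` at `x₊`, and the quasiconvex envelope is below `s` at `x₋`.
Without negative terms `x₊ = p`, and cheap talk itself would beat `s`.

Local improvability is sufficient (`valueCT_lt_valueMD_of_ctLocallyImprovable`): take a little mass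
from an `s`-splitting of `p` and spend it on splittings of `rμ + (1-r)p` with a value above `s` and
of `μ` with a value below `s`, in the proportion that cancels the `μ`-components of the value
change. What remains is a positive multiple of `p`. The mass can be taken because `μ` is an affine
combination of the beliefs of the splitting, whose weights are all positive.

Randomness (`isRandom_of_induces`): a degenerate mechanism produces one belief per state, and zero
covariance forces `V` to equal its mean at each of them, so `τ` would be a cheap talk distribution.
Conversely, `MDFeasible.exists_mechanism` implements every feasible pair by sending the belief
itself as the message. -/

/-- The convex hull of a compact set in a finite-dimensional space is compact. -/
theorem isCompact_convexHull_of_finiteDimensional {E : Type*} [NormedAddCommGroup E]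
    [NormedSpace ℝ E] [FiniteDimensional ℝ E] {s : Set E} (hs : IsCompact s) :
    IsCompact (convexHull ℝ s) := by
  rcases s.eq_empty_or_nonempty with rfl | ⟨x₀, hx₀⟩
  · simp
  set n := Module.finrank ℝ E + 1
  -- Carathéodory bounds the number of points, so the hull is a continuous image of a compact set.
  -- Spare slots get weight zero at `x₀`.
  have key : convexHull ℝ s = (fun q : (Fin n → ℝ) × (Fin n → E) => ∑ i, q.1 i • q.2 i) ''
      (stdSimplex ℝ (Fin n) ×ˢ Set.pi univ fun _ => s) := by
    apply Subset.antisymm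
    · intro x hx
      obtain ⟨ι, _, z, w, hz, hind, hw, hw1, rfl⟩ := eq_pos_convex_span_of_mem_convexHull hx
      have hcard : Fintype.card ι ≤ Fintype.card (Fin n) := by
        rw [Fintype.card_fin]
        exact hind.card_le_finrank_succ.trans
          (Nat.add_le_add_right (Submodule.finrank_le _) 1)
      obtain ⟨e⟩ := Function.Embedding.nonempty_of_card_le hcard
      have hwe : ∀ i, Function.extend e w 0 (e i) = w i := fun i => e.injective.extend_apply _ _ _
      have hze : ∀ i, Function.extend e z (fun _ => x₀) (e i) = z i :=
        fun i => e.injective.extend_apply _ _ _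
      have hout : ∀ j, j ∉ range e → Function.extend e w 0 j = 0 := by
        intro j hj
        rw [Function.extend_apply' _ _ _ (by simpa using hj)]
        rfl
      refine ⟨(Function.extend e w 0, Function.extend e z fun _ => x₀), ⟨⟨fun j => ?_, ?_⟩, ?_⟩, ?_⟩
      · by_cases hj : j ∈ range e
        · obtain ⟨i, rfl⟩ := hj
          simp only [hwe]
          exact (hw i).le
        · exact (hout j hj).ge
      · rw [← hw1]
        exact (Fintype.sum_of_injective e e.injective _ _ (fun j hj => hout j hj)
          fun i => (hwe i).symm).symm
      · intro j _
        by_cases hj : j ∈ range e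
        · obtain ⟨i, rfl⟩ := hj
          simp only [hze]
          exact hz ⟨i, rfl⟩
        · simp only []
          rw [Function.extend_apply' _ _ _ (by simpa using hj)]
          exact hx₀
      · refine (Fintype.sum_of_injective e e.injective _ _ (fun j hj => ?_) fun i => ?_).symm
        · simp only [hout j hj, zero_smul]
        · simp only [hwe, hze]
    · rintro _ ⟨⟨w, z⟩, ⟨hw, hz⟩, rfl⟩
      exact mem_convexHull_of_exists_fintype w z hw.1 hw.2 (fun i => hz i trivial) rfl
  rw [key]
  exact ((isCompact_stdSimplex ℝ (Fin n)).prod (isCompact_univ_pi fun _ => hs)).image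
    (by fun_prop)

/-! ### Measurable selections from compact-valued maps -/

section Selection

variable {X : Type*} {A : Type*} [TopologicalSpace A]

/-- A set-valued map is hit-measurable if the set of points whose value meets `K` is measurable
for every closed `K`. -/
def HitMeasurable [MeasurableSpace X] (F : X → Set A) : Prop :=
  ∀ K : Set A, IsClosed K → MeasurableSet {x | (F x ∩ K).Nonempty}

/-- The minimizers of `g` on `F x`. -/
def argminOver (g : A → ℝ) (F : X → Set A) (x : X) : Set A :=
  {a | a ∈ F x ∧ ∀ b ∈ F x, g a ≤ g b}

theorem argminOver_nonempty {g : A → ℝ} (hg : Continuous g) {F : X → Set A} {x : X}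
    (hc : IsCompact (F x)) (hne : (F x).Nonempty) : (argminOver g F x).Nonempty := by
  obtain ⟨a, ha, hmin⟩ := hc.exists_isMinOn hne hg.continuousOn
  exact ⟨a, ha, fun b hb => hmin hb⟩

theorem isCompact_argminOver {g : A → ℝ} (hg : Continuous g) {F : X → Set A} {x : X}
    (hc : IsCompact (F x)) : IsCompact (argminOver g F x) := by
  have : argminOver g F x = F x ∩ ⋂ b ∈ F x, {a | g a ≤ g b} := by
    ext a
    simp [argminOver]
  rw [this]
  exact hc.inter_right (isClosed_biInter fun b _ => isClosed_le hg continuous_const)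

/-- Some minimizer lies in `K` iff `F x` meets `K` and every rational level reached by `g` on `F x`
is already reached on `F x ∩ K`; this is a countable condition. -/
theorem HitMeasurable.argminOver [MeasurableSpace X] {g : A → ℝ} (hg : Continuous g)
    {F : X → Set A} (hF : HitMeasurable F) (hc : ∀ x, IsCompact (F x)) :
    HitMeasurable (argminOver g F) := by
  intro K hK
  have hle : ∀ q : ℚ, IsClosed {a | g a ≤ q} := fun q => isClosed_le hg continuous_const
  have key : {x | (Mediation.argminOver g F x ∩ K).Nonempty} =
      {x | (F x ∩ K).Nonempty} ∩ ⋂ q : ℚ, ({x | (F x ∩ {a | g a ≤ q}).Nonempty}ᶜ ∪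
        {x | (F x ∩ (K ∩ {a | g a ≤ q})).Nonempty}) := by
    ext x
    simp only [mem_ofPred_eq, mem_inter_iff, mem_iInter, mem_union, mem_compl_iff]
    constructor
    · rintro ⟨a, ⟨haF, hmin⟩, haK⟩
      refine ⟨⟨a, haF, haK⟩, fun q => ?_⟩
      by_cases h : (F x ∩ {a | g a ≤ q}).Nonempty
      · obtain ⟨b, hbF, hb⟩ := h
        exact Or.inr ⟨a, haF, haK, (hmin b hbF).trans hb⟩
      · exact Or.inl h
    · rintro ⟨hK', h⟩
      obtain ⟨a, ⟨haF, haK⟩, hmin⟩ :=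
        ((hc x).inter_right hK).exists_isMinOn hK' hg.continuousOn
      refine ⟨a, ⟨haF, fun b hb => ?_⟩, haK⟩
      by_contra! hlt
      obtain ⟨q, hbq, hqa⟩ := exists_rat_btwn hlt
      rcases h q with h | ⟨c, hcF, hcK, hcq⟩
      · exact h ⟨b, hb, hbq.le⟩
      · exact absurd (hmin ⟨hcF, hcK⟩) (not_le.2 (lt_of_le_of_lt hcq hqa))
  rw [key]
  exact (hF K hK).inter (MeasurableSet.iInter fun q =>
    (hF _ (hle q)).compl.union (hF _ (hK.inter (hle q))))

end Selection

/-- A hit-measurable map with nonempty compact values in a compact metric space has a measurable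
selection. -/
theorem HitMeasurable.exists_measurable_selection {X : Type*} [MeasurableSpace X] {A : Type*}
    [MetricSpace A] [CompactSpace A] [Nonempty A] [MeasurableSpace A] [BorelSpace A]
    {F : X → Set A} (hF : HitMeasurable F) (hc : ∀ x, IsCompact (F x))
    (hne : ∀ x, (F x).Nonempty) : ∃ f : X → A, Measurable f ∧ ∀ x, f x ∈ F x := by
  let d := TopologicalSpace.denseSeq A
  -- Minimizing the distance to each `d k` in turn gives decreasing compact sets. Two points of
  -- their intersection have equal distances to a dense set, hence coincide.
  let G : ℕ → X → Set A := fun n => Nat.rec F (fun k H => Mediation.argminOver (fun a => dist a (d k)) H) n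
  have hdc : ∀ k, Continuous fun a => dist a (d k) := fun k => by fun_prop
  have hGc : ∀ n x, IsCompact (G n x) := by
    intro n
    induction n with
    | zero => exact hc
    | succ n ih => exact fun x => isCompact_argminOver (hdc n) (ih x)
  have hGne : ∀ n x, (G n x).Nonempty := by
    intro n
    induction n with
    | zero => exact hne
    | succ n ih => exact fun x => argminOver_nonempty (hdc n) (hGc n x) (ih x)
  have hGm : ∀ n, HitMeasurable (G n) := by
    intro n
    induction n with
    | zero => exact hF
    | succ n ih => exact ih.argminOver (hdc n) (hGc n)
  have hanti : ∀ n x, G (n + 1) x ⊆ G n x := fun n x a ha => ha.1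
  have hex : ∀ x, (⋂ n, G n x).Nonempty := fun x =>
    IsCompact.nonempty_iInter_of_sequence_nonempty_isCompact_isClosed _ (hanti · x) (hGne · x)
      (hGc 0 x) fun n => (hGc n x).isClosed
  have huniq : ∀ x, ∀ a ∈ ⋂ n, G n x, ∀ b ∈ ⋂ n, G n x, a = b := by
    intro x a ha b hb
    rw [mem_iInter] at ha hb
    have hdist : ∀ y, dist a y = dist b y := by
      have h1 : Continuous fun y => dist a y := by fun_prop
      have h2 : Continuous fun y => dist b y := by fun_prop
      refine congrFun (Continuous.ext_on (TopologicalSpace.denseRange_denseSeq A) h1 h2 ?_)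
      rintro _ ⟨k, rfl⟩
      exact le_antisymm ((ha (k + 1)).2 b (hb k)) ((hb (k + 1)).2 a (ha k))
    have := hdist b
    rw [dist_self] at this
    exact dist_eq_zero.1 this
  choose f hf using hex
  refine ⟨f, measurable_of_isClosed fun K hK => ?_, fun x => mem_iInter.1 (hf x) 0⟩
  -- By compactness, if every `G n x` meets `K`, so does the intersection, which is `{f x}`.
  have key : f ⁻¹' K = ⋂ n, {x | (G n x ∩ K).Nonempty} := by
    ext x
    simp only [mem_preimage, mem_iInter, mem_ofPred_eq]
    constructor
    · exact fun h n => ⟨f x, mem_iInter.1 (hf x) n, h⟩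
    · intro h
      obtain ⟨a, ha⟩ := IsCompact.nonempty_iInter_of_sequence_nonempty_isCompact_isClosed
        (fun n => G n x ∩ K) (fun n => inter_subset_inter_left _ (hanti n x)) h
        ((hGc 0 x).inter_right hK) fun n => (hGc n x).isClosed.inter hK
      rw [mem_iInter] at ha
      rw [huniq x (f x) (hf x) a (mem_iInter.2 fun n => (ha n).1)]
      exact (ha 0).2
  rw [key]
  exact MeasurableSet.iInter fun n => hGm n K hK

/-! ### Symmetry `uS ↦ -uS`, which exchanges the upper and lower values -/

section Neg

variable {Ω : Type*} [Fintype Ω] {A : Type*} {uS : A → ℝ} {uR : Ω → A → ℝ}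

theorem valueCorr_neg (μ : Ω → ℝ) : valueCorr (-uS) uR μ = -valueCorr uS uR μ := by
  rw [valueCorr, valueCorr, ← convexHull_neg, ← image_neg_eq_neg, ← image_comp]
  rfl

theorem upperValue_neg (μ : Ω → ℝ) : upperValue (-uS) uR μ = -lowerValue uS uR μ := by
  rw [upperValue, lowerValue, valueCorr_neg, Real.sSup_neg]

end Neg

/-! ### Best responses and the value correspondence -/

section Payoffs

variable {Ω : Type*} [Fintype Ω] {A : Type*} [MetricSpace A]
  {uS : A → ℝ} {uR : Ω → A → ℝ}

theorem isClosed_graph_bestResponses (huR : ∀ ω, Continuous (uR ω)) :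
    IsClosed {q : (Ω → ℝ) × A | q.2 ∈ bestResponses uR q.1} := by
  have : {q : (Ω → ℝ) × A | q.2 ∈ bestResponses uR q.1} =
      ⋂ a' : A, {q | ∑ ω, q.1 ω * uR ω a' ≤ ∑ ω, q.1 ω * uR ω q.2} := by
    ext q
    simp [bestResponses]
  rw [this]
  exact isClosed_iInter fun a' => isClosed_le (by fun_prop) (by fun_prop)

variable [CompactSpace A]

theorem isCompact_bestResponses (huR : ∀ ω, Continuous (uR ω)) (μ : Ω → ℝ) :
    IsCompact (bestResponses uR μ) :=
  ((isClosed_graph_bestResponses huR).preimage (Continuous.prodMk_right μ)).isCompact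

theorem bestResponses_nonempty [Nonempty A] (huR : ∀ ω, Continuous (uR ω)) (μ : Ω → ℝ) :
    (bestResponses uR μ).Nonempty := by
  have hcont : Continuous fun a => ∑ ω, μ ω * uR ω a := by fun_prop
  obtain ⟨a, -, ha⟩ := isCompact_univ.exists_isMaxOn univ_nonempty hcont.continuousOn
  exact ⟨a, fun a' => ha (mem_univ a')⟩

/-- The set is the projection of a closed part of the graph along the compact factor `A`. -/
theorem isClosed_hit_bestResponses (huR : ∀ ω, Continuous (uR ω)) {K : Set A} (hK : IsClosed K) :
    IsClosed {μ : Ω → ℝ | (bestResponses uR μ ∩ K).Nonempty} := by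
  have : {μ : Ω → ℝ | (bestResponses uR μ ∩ K).Nonempty} =
      Prod.fst '' ({q : (Ω → ℝ) × A | q.2 ∈ bestResponses uR q.1} ∩ Prod.snd ⁻¹' K) := by
    ext μ
    constructor
    · rintro ⟨a, ha, haK⟩
      exact ⟨(μ, a), ⟨ha, haK⟩, rfl⟩
    · rintro ⟨⟨μ, a⟩, ⟨ha, haK⟩, rfl⟩
      exact ⟨a, ha, haK⟩
  rw [this]
  exact isClosedMap_fst_of_compactSpace _
    ((isClosed_graph_bestResponses huR).inter (hK.preimage continuous_snd))

theorem hitMeasurable_bestResponses (huR : ∀ ω, Continuous (uR ω)) :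
    HitMeasurable fun μ : Belief Ω => bestResponses uR μ.1 := fun _ hK =>
  ((isClosed_hit_bestResponses huR hK).preimage continuous_subtype_val).measurableSet

theorem exists_abs_bound (huS : Continuous uS) (uR : Ω → A → ℝ) :
    ∃ B : ℝ, ∀ μ, ∀ v ∈ valueCorr uS uR μ, |v| ≤ B := by
  obtain ⟨B, hB⟩ := (isCompact_range huS).isBounded.exists_norm_le
  refine ⟨B, fun μ v hv => ?_⟩
  rw [abs_le]
  refine (convexHull_min (t := Icc (-B) B) ?_ (convex_Icc _ _)) hv
  rintro _ ⟨a, -, rfl⟩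
  exact abs_le.1 (hB _ (mem_range_self a))

variable [Nonempty A]

theorem valueCorr_eq_Icc_image (huS : Continuous uS) (huR : ∀ ω, Continuous (uR ω)) (μ : Ω → ℝ) :
    ∃ a ∈ bestResponses uR μ, ∃ b ∈ bestResponses uR μ,
      lowerValue uS uR μ = uS a ∧ upperValue uS uR μ = uS b ∧
      valueCorr uS uR μ = Icc (uS a) (uS b) := by
  obtain ⟨a, ha, hmin⟩ := (isCompact_bestResponses huR μ).exists_isMinOn
    (bestResponses_nonempty huR μ) huS.continuousOn
  obtain ⟨b, hb, hmax⟩ := (isCompact_bestResponses huR μ).exists_isMaxOn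
    (bestResponses_nonempty huR μ) huS.continuousOn
  have hab : uS a ≤ uS b := hmin hb
  have h : valueCorr uS uR μ = Icc (uS a) (uS b) := by
    apply Subset.antisymm
    · refine convexHull_min ?_ (convex_Icc _ _)
      rintro _ ⟨c, hc, rfl⟩
      exact ⟨hmin hc, hmax hc⟩
    · rw [← segment_eq_Icc hab]
      exact segment_subset_convexHull (mem_image_of_mem _ ha) (mem_image_of_mem _ hb)
  refine ⟨a, ha, b, hb, ?_, ?_, h⟩
  · rw [lowerValue, h, csInf_Icc hab]
  · rw [upperValue, h, csSup_Icc hab]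

theorem valueCorr_eq_Icc (huS : Continuous uS) (huR : ∀ ω, Continuous (uR ω)) (μ : Ω → ℝ) :
    valueCorr uS uR μ = Icc (lowerValue uS uR μ) (upperValue uS uR μ) := by
  obtain ⟨a, -, b, -, h1, h2, h3⟩ := valueCorr_eq_Icc_image huS huR μ
  rw [h1, h2, h3]

theorem lowerValue_le_upperValue (huS : Continuous uS) (huR : ∀ ω, Continuous (uR ω))
    (μ : Ω → ℝ) : lowerValue uS uR μ ≤ upperValue uS uR μ := by
  obtain ⟨a, ha, b, -, h1, h2, h3⟩ := valueCorr_eq_Icc_image huS huR μ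
  have : uS a ∈ valueCorr uS uR μ := subset_convexHull _ _ (mem_image_of_mem _ ha)
  rw [h3] at this
  rw [h1, h2]
  exact this.2

theorem upperValue_mem_valueCorr (huS : Continuous uS) (huR : ∀ ω, Continuous (uR ω))
    (μ : Ω → ℝ) : upperValue uS uR μ ∈ valueCorr uS uR μ := by
  rw [valueCorr_eq_Icc huS huR]
  exact right_mem_Icc.2 (lowerValue_le_upperValue huS huR μ)

theorem le_upperValue_iff (huS : Continuous uS) (huR : ∀ ω, Continuous (uR ω)) {c : ℝ}
    {μ : Ω → ℝ} : c ≤ upperValue uS uR μ ↔ (bestResponses uR μ ∩ {a | c ≤ uS a}).Nonempty := by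
  obtain ⟨a, ha, b, hb, h1, h2, h3⟩ := valueCorr_eq_Icc_image huS huR μ
  constructor
  · exact fun h => ⟨b, hb, by rwa [h2] at h⟩
  · rintro ⟨x, hx, hcx⟩
    have : uS x ∈ valueCorr uS uR μ := subset_convexHull _ _ (mem_image_of_mem _ hx)
    rw [valueCorr_eq_Icc huS huR] at this
    exact le_trans hcx this.2

theorem isClosed_le_upperValue (huS : Continuous uS) (huR : ∀ ω, Continuous (uR ω)) (c : ℝ) :
    IsClosed {μ | c ≤ upperValue uS uR μ} := by
  simp only [le_upperValue_iff huS huR]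
  exact isClosed_hit_bestResponses huR (isClosed_le continuous_const huS)

theorem isClosed_lowerValue_le (huS : Continuous uS) (huR : ∀ ω, Continuous (uR ω)) (c : ℝ) :
    IsClosed {μ | lowerValue uS uR μ ≤ c} := by
  convert isClosed_le_upperValue huS.neg huR (-c) using 3
  rw [upperValue_neg, neg_le_neg_iff]

/-- The best responses that minimize `-uS` again form a hit-measurable map with nonempty compact
values. -/
theorem exists_measurable_bestResponse_eq_upperValue [MeasurableSpace A] [BorelSpace A]
    (huS : Continuous uS) (huR : ∀ ω, Continuous (uR ω)) :
    ∃ f : Belief Ω → A, Measurable f ∧ (∀ μ, f μ ∈ bestResponses uR μ.1) ∧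
      ∀ μ, uS (f μ) = upperValue uS uR μ.1 := by
  have hc : ∀ μ : Belief Ω, IsCompact (bestResponses uR μ.1) :=
    fun μ => isCompact_bestResponses huR μ.1
  have hne : ∀ μ : Belief Ω, (bestResponses uR μ.1).Nonempty :=
    fun μ => bestResponses_nonempty huR μ.1
  have hcont : Continuous fun a => -uS a := huS.neg
  obtain ⟨f, hf, hmem⟩ := ((hitMeasurable_bestResponses huR).argminOver hcont hc
    ).exists_measurable_selection (fun μ => isCompact_argminOver hcont (hc μ))
    (fun μ => argminOver_nonempty hcont (hc μ) (hne μ))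
  refine ⟨f, hf, fun μ => (hmem μ).1, fun μ => ?_⟩
  obtain ⟨a, ha, b, hb, h1, h2, h3⟩ := valueCorr_eq_Icc_image huS huR μ.1
  have h4 : uS (f μ) ∈ valueCorr uS uR μ.1 := subset_convexHull _ _ (mem_image_of_mem _ (hmem μ).1)
  rw [h3] at h4
  have h5 := (hmem μ).2 b hb
  rw [h2]
  exact le_antisymm h4.2 (neg_le_neg_iff.1 h5)

theorem exists_measurable_bestResponse_eq_lowerValue [MeasurableSpace A] [BorelSpace A]
    (huS : Continuous uS) (huR : ∀ ω, Continuous (uR ω)) :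
    ∃ f : Belief Ω → A, Measurable f ∧ (∀ μ, f μ ∈ bestResponses uR μ.1) ∧
      ∀ μ, uS (f μ) = lowerValue uS uR μ.1 := by
  obtain ⟨f, hf, hmem, h⟩ := exists_measurable_bestResponse_eq_upperValue
    (uS := -uS) huS.neg huR
  refine ⟨f, hf, hmem, fun μ => ?_⟩
  have := h μ
  rw [upperValue_neg, Pi.neg_apply] at this
  linarith

end Payoffs

/-! ### Envelopes in terms of finite splittings -/

section Envelopes

variable {Ω : Type*} [Fintype Ω] {A : Type*} {uS : A → ℝ} {uR : Ω → A → ℝ}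

theorem quasiconvexEnvelope_eq_neg (μ : Ω → ℝ) :
    quasiconvexEnvelope uS uR μ = -quasiconcaveEnvelope (-uS) uR μ := by
  rw [quasiconvexEnvelope, quasiconcaveEnvelope, ← Real.sSup_neg]
  congr 1
  ext x
  simp only [mem_ofPred_eq, Set.mem_neg]
  constructor
  · rintro ⟨f, hf, hle, rfl⟩
    refine ⟨-f, fun r => ?_, fun ν hν => ?_, rfl⟩
    · simpa only [Pi.neg_apply, le_neg] using hf (-r)
    · rw [upperValue_neg]
      exact neg_le_neg (hle ν hν)
  · rintro ⟨f, hf, hle, hx⟩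
    refine ⟨-f, fun r => ?_, fun ν hν => ?_, ?_⟩
    · simpa only [Pi.neg_apply, neg_le] using hf (-r)
    · have := hle ν hν
      rw [upperValue_neg] at this
      exact neg_le.1 this
    · rw [Pi.neg_apply, ← hx, neg_neg]

variable [MetricSpace A] [CompactSpace A] [Nonempty A]

theorem upperValue_le_of_bound (huS : Continuous uS) (huR : ∀ ω, Continuous (uR ω)) {B : ℝ}
    (hB : ∀ μ, ∀ v ∈ valueCorr uS uR μ, |v| ≤ B) (μ : Ω → ℝ) : upperValue uS uR μ ≤ B :=
  (abs_le.1 (hB μ _ (upperValue_mem_valueCorr huS huR μ))).2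

/-- Otherwise the function with value `max s B` on the hull and `s` off it is a quasiconcave
majorant, with value `s` at `μ`. Its superlevel sets are the simplex, its intersection with the
hull, and the empty set. -/
theorem mem_convexHull_of_lt_quasiconcaveEnvelope (huS : Continuous uS)
    (huR : ∀ ω, Continuous (uR ω)) {μ : Ω → ℝ} (hμ : μ ∈ stdSimplex ℝ Ω) {s : ℝ}
    (hs : s < quasiconcaveEnvelope uS uR μ) :
    μ ∈ convexHull ℝ {ν ∈ stdSimplex ℝ Ω | s < upperValue uS uR ν} := by
  classical
  set C := convexHull ℝ {ν ∈ stdSimplex ℝ Ω | s < upperValue uS uR ν} with hC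
  obtain ⟨B, hB⟩ := exists_abs_bound huS uR
  by_contra hμC
  refine absurd hs (not_lt.2 ?_)
  have hCconv : Convex ℝ C := convex_convexHull ℝ _
  have hle : ∀ ν ∈ stdSimplex ℝ Ω,
      upperValue uS uR ν ≤ if ν ∈ C then max s B else s := by
    intro ν hν
    split_ifs with h
    · exact (upperValue_le_of_bound huS huR hB ν).trans (le_max_right _ _)
    · by_contra! hlt
      exact h (subset_convexHull ℝ _ ⟨hν, hlt⟩)
  refine csInf_le ?_ ⟨fun ν => if ν ∈ C then max s B else s, fun r => ?_, hle, ?_⟩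
  · refine ⟨upperValue uS uR μ, ?_⟩
    rintro _ ⟨f, -, hf, rfl⟩
    exact hf μ hμ
  · by_cases h1 : r ≤ s
    · convert convex_stdSimplex ℝ Ω using 1
      refine Set.ext fun x => ⟨fun h => h.1, fun h => ⟨h, ?_⟩⟩
      simp only
      split_ifs
      · exact h1.trans (le_max_left _ _)
      · exact h1
    · by_cases h2 : r ≤ max s B
      · convert (convex_stdSimplex ℝ Ω).inter hCconv using 1
        refine Set.ext fun x => ⟨fun h => ⟨h.1, ?_⟩, fun h => ⟨h.1, ?_⟩⟩
        · by_contra hx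
          have := h.2
          simp only [if_neg hx] at this
          exact h1 this
        · simpa only [if_pos h.2] using h2
      · convert convex_empty (𝕜 := ℝ) (E := Ω → ℝ) using 1
        refine Set.eq_empty_of_forall_notMem fun x hx => h2 (hx.2.trans ?_)
        simp only
        split_ifs
        · exact le_rfl
        · exact le_max_left _ _
  · simp only [if_neg hμC]

theorem le_quasiconcaveEnvelope_of_mem_convexHull (huS : Continuous uS)
    (huR : ∀ ω, Continuous (uR ω)) {μ : Ω → ℝ} {c : ℝ}
    (hμ : μ ∈ convexHull ℝ {ν ∈ stdSimplex ℝ Ω | c ≤ upperValue uS uR ν}) :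
    c ≤ quasiconcaveEnvelope uS uR μ := by
  obtain ⟨B, hB⟩ := exists_abs_bound huS uR
  refine le_csInf ⟨_, fun _ => B, fun r => ?_,
    fun ν _ => upperValue_le_of_bound huS huR hB ν, rfl⟩ ?_
  · by_cases h : r ≤ B
    · simpa [h] using convex_stdSimplex ℝ Ω
    · simpa [h] using convex_empty (𝕜 := ℝ) (E := Ω → ℝ)
  · rintro _ ⟨f, hf, hle, rfl⟩
    have hsub : {ν ∈ stdSimplex ℝ Ω | c ≤ upperValue uS uR ν} ⊆ {ν ∈ stdSimplex ℝ Ω | c ≤ f ν} :=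
      fun ν hν => ⟨hν.1, hν.2.trans (hle ν hν.1)⟩
    exact (convexHull_min hsub (hf c) hμ).2

/-- On the segment from a belief whose largest value is below `c` to a belief whose largest value
is at least `c`, some belief other than the first endpoint has the value `c`. -/
theorem exists_lineMap_mem_valueCorr (huS : Continuous uS) (huR : ∀ ω, Continuous (uR ω))
    {μ x : Ω → ℝ} {c : ℝ} (hμ : upperValue uS uR μ < c) (hx : c ≤ upperValue uS uR x) :
    ∃ t ∈ Ioc (0 : ℝ) 1, c ∈ valueCorr uS uR (AffineMap.lineMap μ x t) := by
  have hcont : Continuous (AffineMap.lineMap μ x : ℝ → Ω → ℝ) := AffineMap.lineMap_continuous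
  -- The closed sets where the lower value is at most `c` and where the upper value is at least `c`
  -- cover the segment, so by connectedness they share a point; there `c` lies in the interval `𝐕`.
  obtain ⟨t, ht, ht1, ht2⟩ := isPreconnected_closed_iff.1 (isPreconnected_Icc (a := (0 : ℝ)) (b := 1))
    _ _ ((isClosed_lowerValue_le huS huR c).preimage hcont)
    ((isClosed_le_upperValue huS huR c).preimage hcont)
    (fun t _ => by
      rcases le_total (lowerValue uS uR (AffineMap.lineMap μ x t)) c with h | h
      · exact Or.inl h
      · exact Or.inr (h.trans (lowerValue_le_upperValue huS huR _)))
    ⟨0, by simp, by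
      simpa using (lowerValue_le_upperValue huS huR _).trans hμ.le⟩
    ⟨1, by simp, by simpa using hx⟩
  simp only [mem_preimage, mem_ofPred_eq] at ht1 ht2
  refine ⟨t, ⟨lt_of_le_of_ne ht.1 ?_, ht.2⟩, ?_⟩
  · rintro rfl
    rw [AffineMap.lineMap_apply_zero] at ht2
    exact absurd hμ (not_lt.2 ht2)
  · rw [valueCorr_eq_Icc huS huR]
    exact ⟨ht1, ht2⟩

/-- A value below the quasiconcave envelope is exceeded by a value that is available at all
beliefs of some finite splitting. -/
theorem exists_mem_convexHull_of_lt_quasiconcaveEnvelope (huS : Continuous uS)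
    (huR : ∀ ω, Continuous (uR ω)) {μ : Ω → ℝ} (hμ : μ ∈ stdSimplex ℝ Ω) {s : ℝ}
    (hs : s < quasiconcaveEnvelope uS uR μ) :
    ∃ v > s, μ ∈ convexHull ℝ {ν ∈ stdSimplex ℝ Ω | v ∈ valueCorr uS uR ν} := by
  by_cases hsμ : s < upperValue uS uR μ
  · exact ⟨_, hsμ, subset_convexHull ℝ _ ⟨hμ, upperValue_mem_valueCorr huS huR μ⟩⟩
  have hmem := mem_convexHull_of_lt_quasiconcaveEnvelope huS huR hμ hs
  obtain ⟨ι, _, w, x, hw0, hw1, hx, hsum⟩ := mem_convexHull_iff_exists_fintype.1 hmem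
  have hne : (Finset.univ : Finset ι).Nonempty := by
    by_contra h
    rw [Finset.not_nonempty_iff_eq_empty] at h
    rw [h, Finset.sum_empty] at hw1
    exact zero_ne_one hw1
  obtain ⟨i₀, -, hi₀⟩ := Finset.exists_min_image Finset.univ (fun i => upperValue uS uR (x i)) hne
  set v := upperValue uS uR (x i₀)
  refine ⟨v, (hx i₀).2, ?_⟩
  have hμv : upperValue uS uR μ < v := (not_lt.1 hsμ).trans_lt (hx i₀).2
  -- Each `x i` is pulled towards `μ` until `v` itself is available. The weights `w i / t i` undo
  -- the contraction: the displacements from `μ` still sum to `∑ w i • (x i - μ) = 0`.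
  choose t ht htv using fun i =>
    exists_lineMap_mem_valueCorr huS huR hμv (hi₀ i (Finset.mem_univ i))
  have hpos : 0 < ∑ i, w i / t i := by
    refine lt_of_lt_of_le one_pos (hw1.ge.trans (Finset.sum_le_sum fun i _ => ?_))
    exact le_div_self (hw0 i) (ht i).1 (ht i).2
  have hcm := Finset.univ.centerMass_mem_convexHull (R := ℝ)
    (s := {ν ∈ stdSimplex ℝ Ω | v ∈ valueCorr uS uR ν})
    (w := fun i => w i / t i) (z := fun i => AffineMap.lineMap μ (x i) (t i))
    (fun i _ => div_nonneg (hw0 i) (ht i).1.le) hpos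
    fun i _ => ⟨(convex_stdSimplex ℝ Ω).lineMap_mem hμ (hx i).1 ⟨(ht i).1.le, (ht i).2⟩, htv i⟩
  convert hcm using 1
  rw [Finset.centerMass, eq_inv_smul_iff₀ hpos.ne', Finset.sum_smul]
  have h1 : ∀ i, (w i / t i) • (AffineMap.lineMap μ (x i) (t i) : Ω → ℝ) =
      (w i / t i) • μ + (w i • x i - w i • μ) := by
    intro i
    have : w i / t i * t i = w i := div_mul_cancel₀ _ (ht i).1.ne'
    rw [AffineMap.lineMap_apply_module', smul_add, smul_smul, this, smul_sub, add_comm]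
  rw [Finset.sum_congr rfl fun i _ => h1 i, Finset.sum_add_distrib, Finset.sum_sub_distrib,
    hsum, ← Finset.sum_smul, ← Finset.sum_smul, hw1, one_smul, sub_self, add_zero]

end Envelopes

/-! ### Finitely supported distributions -/

section FiniteMixtures

/-- The finitely supported probability measure with the weights `w` at the points `x`. -/
noncomputable def finiteMixture {X ι : Type*} [MeasurableSpace X] [Fintype ι] (w : ι → ℝ)
    (x : ι → X) (hw0 : ∀ i, 0 ≤ w i) (hw1 : ∑ i, w i = 1) : ProbabilityMeasure X :=
  ⟨∑ i, ENNReal.ofReal (w i) • Measure.dirac (x i), ⟨by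
    simp [← ENNReal.ofReal_sum_of_nonneg fun i _ => hw0 i, hw1]⟩⟩

variable {X ι : Type*} [MeasurableSpace X] [Fintype ι] {w : ι → ℝ} {x : ι → X}

theorem integral_finiteMixture [MeasurableSingletonClass X] (hw0 : ∀ i, 0 ≤ w i)
    (hw1 : ∑ i, w i = 1) (g : X → ℝ) :
    ∫ y, g y ∂(finiteMixture w x hw0 hw1 : Measure X) = ∑ i, w i * g (x i) := by
  have h : (finiteMixture w x hw0 hw1 : Measure X) =
    ∑ i, ENNReal.ofReal (w i) • Measure.dirac (x i) := rfl
  rw [h, integral_finsetSum_measure fun i _ =>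
    (integrable_dirac enorm_lt_top).smul_measure ENNReal.ofReal_ne_top]
  refine Finset.sum_congr rfl fun i _ => ?_
  rw [integral_smul_measure, integral_dirac, ENNReal.toReal_ofReal (hw0 i), smul_eq_mul]

theorem support_finiteMixture_subset [TopologicalSpace X] [T1Space X] [MeasurableSingletonClass X]
    (hw0 : ∀ i, 0 ≤ w i) (hw1 : ∑ i, w i = 1) :
    (finiteMixture w x hw0 hw1 : Measure X).support ⊆ range x := by
  refine Measure.support_subset_of_isClosed (finite_range x).isClosed ?_
  have h : (finiteMixture w x hw0 hw1 : Measure X) =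
    ∑ i, ENNReal.ofReal (w i) • Measure.dirac (x i) := rfl
  rw [mem_ae_iff, h, Measure.finsetSum_apply]
  refine Finset.sum_eq_zero fun i _ => ?_
  rw [Measure.smul_apply, Measure.dirac_apply' _ (finite_range x).measurableSet.compl]
  simp

end FiniteMixtures

/-! ### Feasibility as membership in convex hulls -/

section Feasibility

variable {Ω : Type*} [Fintype Ω]

theorem measurable_belief_apply (ω : Ω) : Measurable fun μ : Belief Ω => μ.1 ω :=
  (measurable_pi_apply ω).comp measurable_subtype_coe

theorem abs_belief_apply_le_one (μ : Belief Ω) (ω : Ω) : |μ.1 ω| ≤ 1 := by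
  rw [abs_of_nonneg (μ.2.1 ω), ← μ.2.2]
  exact Finset.single_le_sum (fun i _ => μ.2.1 i) (Finset.mem_univ ω)

variable {A : Type*} {uS : A → ℝ} {uR : Ω → A → ℝ} {p : Ω → ℝ}

theorem abs_integral_selection_le {B : ℝ} (hB : ∀ μ, ∀ v ∈ valueCorr uS uR μ, |v| ≤ B)
    {V : Belief Ω → ℝ} (hV : IsSelection uS uR V) (τ : ProbabilityMeasure (Belief Ω)) :
    |∫ μ, V μ ∂(τ : Measure (Belief Ω))| ≤ B := by
  simpa using norm_integral_le_of_norm_le_const (μ := (τ : Measure (Belief Ω))) (f := V)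
    (ae_of_all _ fun μ => hB _ _ (hV.2 μ))

variable [MetricSpace A] [CompactSpace A]

theorem IsSelection.memLp (huS : Continuous uS) {V : Belief Ω → ℝ} (hV : IsSelection uS uR V)
    (τ : ProbabilityMeasure (Belief Ω)) (q : ENNReal) : MemLp V q (τ : Measure (Belief Ω)) := by
  obtain ⟨B, hB⟩ := exists_abs_bound huS uR
  exact MemLp.of_bound hV.1.aestronglyMeasurable B (ae_of_all _ fun μ => hB _ _ (hV.2 μ))

theorem memLp_belief_apply (τ : ProbabilityMeasure (Belief Ω)) (ω : Ω) (q : ENNReal) :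
    MemLp (fun μ : Belief Ω => μ.1 ω) q (τ : Measure (Belief Ω)) :=
  MemLp.of_bound (measurable_belief_apply ω).aestronglyMeasurable 1
    (ae_of_all _ fun μ => abs_belief_apply_le_one μ ω)

theorem IsSelection.integrable (huS : Continuous uS) {V : Belief Ω → ℝ}
    (hV : IsSelection uS uR V) (τ : ProbabilityMeasure (Belief Ω)) :
    Integrable V (τ : Measure (Belief Ω)) :=
  memLp_one_iff_integrable.1 (hV.memLp huS τ 1)

theorem IsSelection.integrable_mul (huS : Continuous uS) {V : Belief Ω → ℝ}
    (hV : IsSelection uS uR V) (τ : ProbabilityMeasure (Belief Ω)) (ω : Ω) :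
    Integrable (fun μ : Belief Ω => V μ * μ.1 ω) (τ : Measure (Belief Ω)) :=
  (hV.memLp huS τ 2).integrable_mul (memLp_belief_apply τ ω 2)

/-- For Bayes plausible distributions, zero covariance means that the value-weighted mean belief
is proportional to the prior. -/
theorem covariance_eq_zero_iff (huS : Continuous uS) {V : Belief Ω → ℝ}
    (hV : IsSelection uS uR V) {τ : ProbabilityMeasure (Belief Ω)} (hτ : BayesPlausible p τ)
    (ω : Ω) :
    covariance V (fun μ : Belief Ω => μ.1 ω) (τ : Measure (Belief Ω)) = 0 ↔
      ∫ μ, V μ * μ.1 ω ∂(τ : Measure (Belief Ω)) =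
        (∫ μ, V μ ∂(τ : Measure (Belief Ω))) * p ω := by
  rw [covariance_eq_sub (hV.memLp huS τ 2) (memLp_belief_apply τ ω 2), hτ ω, sub_eq_zero]
  rfl

theorem le_valueMD (huS : Continuous uS) {τ : ProbabilityMeasure (Belief Ω)} {V : Belief Ω → ℝ}
    (h : MDFeasible uS uR p τ V) :
    ∫ μ, V μ ∂(τ : Measure (Belief Ω)) ≤ valueMD uS uR p := by
  obtain ⟨B, hB⟩ := exists_abs_bound huS uR
  refine le_csSup ⟨B, ?_⟩ ⟨τ, V, h, rfl⟩
  rintro _ ⟨τ', V', h', rfl⟩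
  exact (abs_le.1 (abs_integral_selection_le hB h'.1 τ')).2

theorem le_valueCT (huS : Continuous uS) {τ : ProbabilityMeasure (Belief Ω)} {V : Belief Ω → ℝ}
    (h : CTFeasible uS uR p τ V) :
    ∫ μ, V μ ∂(τ : Measure (Belief Ω)) ≤ valueCT uS uR p := by
  obtain ⟨B, hB⟩ := exists_abs_bound huS uR
  refine le_csSup ⟨B, ?_⟩ ⟨τ, V, h, rfl⟩
  rintro _ ⟨τ', V', h', rfl⟩
  exact (abs_le.1 (abs_integral_selection_le hB h'.1 τ')).2

theorem CTFeasible.mdFeasible (huS : Continuous uS) {τ : ProbabilityMeasure (Belief Ω)}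
    {V : Belief Ω → ℝ} (h : CTFeasible uS uR p τ V) : MDFeasible uS uR p τ V := by
  obtain ⟨hV, hτ, c, hc⟩ := h
  refine ⟨hV, hτ, fun ω => ?_⟩
  have hae : ∀ᵐ μ ∂(τ : Measure (Belief Ω)), V μ = c :=
    Filter.mem_of_superset Measure.support_mem_ae hc
  rw [covariance_eq_zero_iff huS hV hτ, integral_congr_ae hae,
    integral_congr_ae (g := fun μ => c * μ.1 ω) (hae.mono fun μ h => by simp only [h]),
    integral_const_mul, hτ ω]
  simp

/-- A feasible distribution under mediation can be replaced by finitely many beliefs and best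
responses with the same mean belief and the same value-weighted mean belief. -/
theorem MDFeasible.mem_convexHull (huS : Continuous uS) (huR : ∀ ω, Continuous (uR ω))
    {τ : ProbabilityMeasure (Belief Ω)} {V : Belief Ω → ℝ} (h : MDFeasible uS uR p τ V) :
    (p, (∫ μ, V μ ∂(τ : Measure (Belief Ω))) • p) ∈ convexHull ℝ
      {q : (Ω → ℝ) × (Ω → ℝ) | q.1 ∈ stdSimplex ℝ Ω ∧
        ∃ a ∈ bestResponses uR q.1, q.2 = uS a • q.1} := by
  obtain ⟨hV, hτ, hcov⟩ := h
  set K := {q : (Ω → ℝ) × (Ω → ℝ) | q.1 ∈ stdSimplex ℝ Ω ∧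
        ∃ a ∈ bestResponses uR q.1, q.2 = uS a • q.1} with hK
  -- Compactness makes the hull of `K` closed, so that it contains the mean of any distribution on
  -- it.
  have hKc : IsCompact K := by
    have : K = (fun r : (Ω → ℝ) × A => (r.1, uS r.2 • r.1)) ''
        ((stdSimplex ℝ Ω ×ˢ univ) ∩ {r : (Ω → ℝ) × A | r.2 ∈ bestResponses uR r.1}) := by
      ext ⟨μ, z⟩
      constructor
      · rintro ⟨hμ, a, ha, hz⟩
        obtain rfl : z = uS a • μ := hz
        exact ⟨(μ, a), ⟨⟨hμ, trivial⟩, ha⟩, rfl⟩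
      · rintro ⟨⟨ν, a⟩, ⟨⟨hμ, -⟩, ha⟩, h⟩
        obtain ⟨rfl, rfl⟩ := Prod.mk.inj h
        exact ⟨hμ, a, ha, rfl⟩
    rw [this]
    exact (((isCompact_stdSimplex ℝ Ω).prod isCompact_univ).inter_right
      (isClosed_graph_bestResponses huR)).image (by fun_prop)
  let φ : Belief Ω → (Ω → ℝ) × (Ω → ℝ) := fun μ => (μ.1, V μ • μ.1)
  have hφ1 : ∀ ω, Integrable (fun μ : Belief Ω => μ.1 ω) (τ : Measure (Belief Ω)) :=
    fun ω => memLp_one_iff_integrable.1 (memLp_belief_apply τ ω 1)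
  have hφi : Integrable φ (τ : Measure (Belief Ω)) :=
    (Integrable.of_eval hφ1).prodMk (Integrable.of_eval fun ω => hV.integrable_mul huS τ ω)
  have hmem : ∀ μ, φ μ ∈ convexHull ℝ K := by
    intro μ
    -- At a fixed belief, `c ↦ (μ, c μ)` is affine, so it carries mixtures of payoffs into the hull
    -- of `K`.
    let L : ℝ →ᵃ[ℝ] (Ω → ℝ) × (Ω → ℝ) := AffineMap.lineMap (μ.1, 0) (μ.1, μ.1)
    have hL : ∀ c, L c = (μ.1, c • μ.1) := by
      intro c
      simp [L, AffineMap.lineMap_apply]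
    have h1 : L (V μ) ∈ L '' convexHull ℝ (uS '' bestResponses uR μ.1) :=
      mem_image_of_mem _ (hV.2 μ)
    rw [AffineMap.image_convexHull, hL] at h1
    refine convexHull_mono ?_ h1
    rintro _ ⟨_, ⟨a, ha, rfl⟩, rfl⟩
    rw [hL]
    exact ⟨μ.2, a, ha, rfl⟩
  have hint := (convex_convexHull ℝ K).integral_mem
    (isCompact_convexHull_of_finiteDimensional hKc).isClosed (ae_of_all _ hmem) hφi
  convert hint using 1
  refine Prod.ext ?_ ?_
  · rw [fst_integral hφi]
    funext ω
    rw [eval_integral hφ1]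
    exact (hτ ω).symm
  · rw [snd_integral hφi]
    funext ω
    refine Eq.trans ?_ (eval_integral (fun ω => hV.integrable_mul huS τ ω) ω).symm
    exact ((covariance_eq_zero_iff huS hV hτ ω).1 (hcov ω)).symm

variable [Nonempty A]

/-- A finite splitting of the prior, at all of whose beliefs the value `v` is available, is a cheap
talk distribution with the value `v`. -/
theorem exists_ctFeasible_of_mem_convexHull [MeasurableSpace A] [BorelSpace A]
    (huS : Continuous uS) (huR : ∀ ω, Continuous (uR ω)) {v : ℝ}
    (hp : p ∈ convexHull ℝ {ν ∈ stdSimplex ℝ Ω | v ∈ valueCorr uS uR ν}) :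
    ∃ τ V, CTFeasible uS uR p τ V ∧ ∫ μ, V μ ∂(τ : Measure (Belief Ω)) = v := by
  classical
  obtain ⟨ι, _, w, x, hw0, hw1, hx, hsum⟩ := mem_convexHull_iff_exists_fintype.1 hp
  obtain ⟨f, hf, -, hfu⟩ := exists_measurable_bestResponse_eq_upperValue huS huR
  let y : ι → Belief Ω := fun i => ⟨x i, (hx i).1⟩
  let V : Belief Ω → ℝ := fun μ => if μ ∈ range y then v else uS (f μ)
  have hVy : ∀ i, V (y i) = v := fun i => if_pos (mem_range_self i)
  refine ⟨finiteMixture w y hw0 hw1, V, ⟨⟨?_, fun μ => ?_⟩, fun ω => ?_, v, ?_⟩, ?_⟩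
  · exact Measurable.ite (finite_range y).measurableSet measurable_const
      (huS.measurable.comp hf)
  · simp only [V]
    split_ifs with h
    · obtain ⟨i, rfl⟩ := h
      exact (hx i).2
    · rw [hfu]
      exact upperValue_mem_valueCorr huS huR μ.1
  · rw [integral_finiteMixture, ← hsum, Finset.sum_apply]
    rfl
  · intro μ hμ
    obtain ⟨i, rfl⟩ := support_finiteMixture_subset hw0 hw1 hμ
    exact hVy i
  · rw [integral_finiteMixture]
    simp only [hVy, ← Finset.sum_mul, hw1, one_mul]

/-- The graph of the value correspondence, with the values used to rescale the beliefs. -/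
def scaledGraph (uS : A → ℝ) (uR : Ω → A → ℝ) : Set ((Ω → ℝ) × (Ω → ℝ)) :=
  {q | q.1 ∈ stdSimplex ℝ Ω ∧ ∃ c ∈ valueCorr uS uR q.1, q.2 = c • q.1}

/-- A finite collection of weighted beliefs and values at which the values are uncorrelated with
the beliefs is feasible under mediation; values at coinciding beliefs are averaged. -/
theorem exists_mdFeasible_of_mem_convexHull [MeasurableSpace A] [BorelSpace A]
    (huS : Continuous uS) (huR : ∀ ω, Continuous (uR ω)) (hp1 : ∑ ω, p ω = 1) {v : ℝ}
    (hp : (p, v • p) ∈ convexHull ℝ (scaledGraph uS uR)) :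
    ∃ τ V, MDFeasible uS uR p τ V ∧ ∫ μ, V μ ∂(τ : Measure (Belief Ω)) = v := by
  classical
  obtain ⟨ι, _, w, q, hw0, hw1, hq, hsum⟩ := mem_convexHull_iff_exists_fintype.1 hp
  choose hqs c hc hqc using hq
  have hsum1 : ∀ ω, ∑ i, w i * (q i).1 ω = p ω := fun ω => by
    have := congrFun (congrArg Prod.fst hsum) ω
    simpa [Prod.fst_sum] using this
  have hsum2 : ∀ ω, ∑ i, w i * (c i * (q i).1 ω) = v * p ω := fun ω => by
    have := congrFun (congrArg Prod.snd hsum) ω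
    simpa [Prod.snd_sum, hqc] using this
  obtain ⟨f, hf, -, hfu⟩ := exists_measurable_bestResponse_eq_upperValue huS huR
  let y : ι → Belief Ω := fun i => ⟨(q i).1, hqs i⟩
  -- Several indices may share a belief, with different values. `V` takes their weighted mean, which
  -- stays in the convex set `𝐕(μ)`, and the upper value where no weight sits.
  let W : Belief Ω → ℝ := fun μ => ∑ i with y i = μ, w i
  let V : Belief Ω → ℝ := fun μ =>
    if W μ = 0 then uS (f μ) else (Finset.univ.filter fun i => y i = μ).centerMass w c
  have hW0 : ∀ μ, 0 ≤ W μ := fun μ => Finset.sum_nonneg fun i _ => hw0 i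
  have hWV : ∀ μ, W μ * V μ = ∑ i with y i = μ, w i * c i := by
    intro μ
    by_cases h : W μ = 0
    · rw [h, zero_mul]
      refine (Finset.sum_eq_zero fun i hi => ?_).symm
      rw [(Finset.sum_eq_zero_iff_of_nonneg fun i _ => hw0 i).1 h i hi, zero_mul]
    · simp only [V, if_neg h, Finset.centerMass, smul_eq_mul]
      rw [mul_inv_cancel_left₀ h]
  have hVg : ∀ g : Belief Ω → ℝ, ∑ i, w i * (V (y i) * g (y i)) = ∑ i, w i * (c i * g (y i)) := by
    intro g
    rw [← Finset.sum_fiberwise_of_maps_to (s := Finset.univ) (t := Finset.univ.image y) (g := y)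
        fun i _ => Finset.mem_image_of_mem _ (Finset.mem_univ i),
      ← Finset.sum_fiberwise_of_maps_to (s := Finset.univ) (t := Finset.univ.image y) (g := y)
        fun i _ => Finset.mem_image_of_mem _ (Finset.mem_univ i)]
    refine Finset.sum_congr rfl fun μ _ => ?_
    have h1 : ∑ i with y i = μ, w i * (V (y i) * g (y i)) = W μ * V μ * g μ := by
      rw [mul_assoc, Finset.sum_mul]
      refine Finset.sum_congr rfl fun i hi => ?_
      rw [(Finset.mem_filter.1 hi).2]
    rw [h1, hWV, Finset.sum_mul]
    refine Finset.sum_congr rfl fun i hi => ?_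
    rw [(Finset.mem_filter.1 hi).2, mul_assoc]
  have hsel : IsSelection uS uR V := by
    refine ⟨?_, fun μ => ?_⟩
    -- `V` differs from a measurable function at finitely many beliefs only.
    · refine (huS.measurable.comp hf).measurable_of_countable_ne
        ((finite_range y).subset fun μ hμ => ?_).countable
      by_contra hn
      refine hμ ?_
      have : W μ = 0 := Finset.sum_eq_zero fun i hi =>
        absurd ⟨i, (Finset.mem_filter.1 hi).2⟩ hn
      simp only [V, if_pos this, Function.comp_apply]
    · simp only [V]
      split_ifs with h
      · rw [hfu]
        exact upperValue_mem_valueCorr huS huR μ.1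
      · refine (convex_convexHull ℝ _).centerMass_mem (fun i _ => hw0 i)
          (lt_of_le_of_ne (hW0 μ) (Ne.symm h)) fun i hi => ?_
        have := hc i
        rw [show (q i).1 = μ.1 from congrArg Subtype.val (Finset.mem_filter.1 hi).2] at this
        exact this
  have hBP : BayesPlausible p (finiteMixture w y hw0 hw1) := fun ω => by
    rw [integral_finiteMixture]
    exact hsum1 ω
  have hint : ∫ μ, V μ ∂(finiteMixture w y hw0 hw1 : Measure (Belief Ω)) = v := by
    rw [integral_finiteMixture]
    have h1 := hVg fun _ => 1
    simp only [mul_one] at h1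
    rw [h1]
    -- Coordinates of beliefs sum to one, so the value-weighted mean belief determines the mean
    -- value.
    calc ∑ i, w i * c i = ∑ i, ∑ ω, w i * (c i * (q i).1 ω) := by
          refine Finset.sum_congr rfl fun i _ => ?_
          rw [← Finset.mul_sum, ← Finset.mul_sum, (hqs i).2, mul_one]
      _ = ∑ ω, v * p ω := by
          rw [Finset.sum_comm]
          exact Finset.sum_congr rfl fun ω _ => hsum2 ω
      _ = v := by rw [← Finset.mul_sum, hp1, mul_one]
  refine ⟨finiteMixture w y hw0 hw1, V, ⟨hsel, hBP, fun ω => ?_⟩, hint⟩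
  rw [covariance_eq_zero_iff huS hsel hBP, hint, integral_finiteMixture,
    hVg fun μ => μ.1 ω]
  exact hsum2 ω

end Feasibility

/-- Points of zero weight may lie outside `S`. This is what permits splitting a sum by the sign of
its terms. -/
theorem inv_sum_smul_mem_convexHull {E ι : Type*} [AddCommGroup E] [Module ℝ E] [Fintype ι]
    {g : ι → ℝ} {x : ι → E} {S : Set E} (hg : ∀ i, 0 ≤ g i) (hpos : 0 < ∑ i, g i)
    (hx : ∀ i, g i ≠ 0 → x i ∈ S) : (∑ i, g i)⁻¹ • ∑ i, g i • x i ∈ convexHull ℝ S := by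
  classical
  have h : Finset.univ.centerMass g x ∈ convexHull ℝ S := by
    rw [← Finset.centerMass_filter_ne_zero]
    refine Finset.centerMass_mem_convexHull _ (fun i _ => hg i) ?_
      fun i hi => hx i (Finset.mem_filter.1 hi).2
    rwa [Finset.sum_filter_ne_zero]
  exact h

/-! ### Splittings behind the cheap talk hull and the scaled graph -/

section Splittings

/-- A cheap talk distribution with finite support that attains `s` is a finite convex splitting of
the prior with positive weights. -/
theorem exists_splitting_of_mem_cheapTalkHull.{u, v} {Ω : Type u} [Fintype Ω] {A : Type v}
    {uS : A → ℝ} {uR : Ω → A → ℝ} {p : Ω → ℝ} {s : ℝ} {μ : Ω → ℝ}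
    (h : μ ∈ cheapTalkHull uS uR p s) :
    ∃ (ι : Type u) (_ : Fintype ι) (m c : ι → ℝ) (x : ι → Ω → ℝ), (∀ i, 0 < m i) ∧
      (∀ i, x i ∈ stdSimplex ℝ Ω) ∧ (∀ i, s ∈ valueCorr uS uR (x i)) ∧
      ∑ i, m i • x i = p ∧ ∑ i, c i • x i = μ := by
  classical
  obtain ⟨-, τ, ⟨⟨V, -, hτ, -⟩, hs⟩, hfin, hμ⟩ := h
  set T := (τ : Measure (Belief Ω)).support with hT
  have hae : ∀ᵐ ν ∂(τ : Measure (Belief Ω)), ν ∈ T := Measure.support_mem_ae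
  -- The linear span suffices: beliefs have coordinate sum one, so the coefficients of a combination
  -- equal to a belief automatically sum to one.
  have hspan := affineSpan_subset_span (k := ℝ) hμ
  rw [← hfin.coe_toFinset, SetLike.mem_coe,
    Submodule.mem_span_image_finset_iff_exists_fun] at hspan
  obtain ⟨c, hc⟩ := hspan
  refine ⟨hfin.toFinset, inferInstance, fun ν => (τ : Measure (Belief Ω)).real {ν.1},
    c, fun ν => ν.1.1, fun ν => ?_, fun ν => ν.1.2,
    fun ν => hs ν.1 (hfin.mem_toFinset.1 ν.2), ?_, ?_⟩
  · have hν : ν.1 ∈ T := hfin.mem_toFinset.1 ν.2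
    -- Points of a finite support are isolated in it, so each one is an atom.
    have hU : (T \ {ν.1})ᶜ ∈ nhds ν.1 :=
      (hfin.subset sdiff_subset).isClosed.isOpen_compl.mem_nhds (by simp)
    have hpos := (Measure.mem_support_iff_forall _).1 hν _ hU
    have heq : (τ : Measure (Belief Ω)) (T \ {ν.1})ᶜ = (τ : Measure (Belief Ω)) {ν.1} := by
      refine measure_congr ?_
      filter_upwards [hae] with y hy
      apply propext
      change y ∉ T \ {ν.1} ↔ y = ν.1
      simp [hy]
    rw [heq] at hpos
    exact ENNReal.toReal_pos hpos.ne' (measure_ne_top _ _)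
  · funext ω
    rw [← hτ ω]
    have hint : Integrable (fun μ : Belief Ω => μ.1 ω) (τ : Measure (Belief Ω)) :=
      memLp_one_iff_integrable.1 (memLp_belief_apply τ ω 1)
    have h1 := setIntegral_finset hfin.toFinset (f := fun μ : Belief Ω => μ.1 ω) hint.integrableOn
    rw [hfin.coe_toFinset, Measure.restrict_eq_self_of_ae_mem hae] at h1
    rw [h1, Finset.sum_apply]
    exact Finset.sum_coe_sort hfin.toFinset
      (fun ν : Belief Ω => (τ : Measure (Belief Ω)).real {ν} • ν.1 ω)
  · exact hc

variable {Ω : Type*} [Fintype Ω] {A : Type*} {uS : A → ℝ} {uR : Ω → A → ℝ}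

theorem sum_smul_apply_sum {ι : Type*} [Fintype ι] {x : ι → Ω → ℝ}
    (hx : ∀ i, x i ∈ stdSimplex ℝ Ω) (c : ι → ℝ) : ∑ ω, (∑ i, c i • x i) ω = ∑ i, c i := by
  simp only [Finset.sum_apply, Pi.smul_apply, smul_eq_mul]
  rw [Finset.sum_comm]
  refine Finset.sum_congr rfl fun i _ => ?_
  rw [← Finset.mul_sum, (hx i).2, mul_one]

theorem mk_smul_mem_convexHull_scaledGraph {x : Ω → ℝ} {c : ℝ}
    (hx : x ∈ convexHull ℝ {ν ∈ stdSimplex ℝ Ω | c ∈ valueCorr uS uR ν}) :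
    (x, c • x) ∈ convexHull ℝ (scaledGraph uS uR) := by
  let L : (Ω → ℝ) →ₗ[ℝ] (Ω → ℝ) × (Ω → ℝ) := LinearMap.id.prod (c • LinearMap.id)
  have h := mem_image_of_mem L hx
  rw [L.image_convexHull] at h
  refine convexHull_mono ?_ h
  rintro _ ⟨ν, hν, rfl⟩
  exact ⟨hν.1, c, hν.2, rfl⟩

end Splittings

/-! ### Comparison of mediation and cheap talk values -/

section Values

variable {Ω : Type*} [Fintype Ω] {A : Type*} [MetricSpace A] [CompactSpace A] [Nonempty A]
  {uS : A → ℝ} {uR : Ω → A → ℝ} {p : Ω → ℝ}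

/-- The inequality stays strict because the splitting is finite: its smallest upper value still
exceeds `s`. -/
theorem lt_quasiconcaveEnvelope_of_mem_convexHull (huS : Continuous uS)
    (huR : ∀ ω, Continuous (uR ω)) {μ : Ω → ℝ} {s : ℝ}
    (hμ : μ ∈ convexHull ℝ {ν ∈ stdSimplex ℝ Ω | s < upperValue uS uR ν}) :
    s < quasiconcaveEnvelope uS uR μ := by
  obtain ⟨ι, _, w, x, hw0, hw1, hx, hsum⟩ := mem_convexHull_iff_exists_fintype.1 hμ
  have hne : (Finset.univ : Finset ι).Nonempty := by
    by_contra h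
    rw [Finset.not_nonempty_iff_eq_empty] at h
    rw [h, Finset.sum_empty] at hw1
    exact zero_ne_one hw1
  obtain ⟨i₀, -, hi₀⟩ := Finset.exists_min_image Finset.univ (fun i => upperValue uS uR (x i)) hne
  exact (hx i₀).2.trans_le (le_quasiconcaveEnvelope_of_mem_convexHull huS huR
    (mem_convexHull_of_exists_fintype w x hw0 hw1
      (fun i => ⟨(hx i).1, hi₀ i (Finset.mem_univ i)⟩) hsum))

theorem quasiconvexEnvelope_lt_of_mem_convexHull (huS : Continuous uS)
    (huR : ∀ ω, Continuous (uR ω)) {μ : Ω → ℝ} {s : ℝ}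
    (hμ : μ ∈ convexHull ℝ {ν ∈ stdSimplex ℝ Ω | lowerValue uS uR ν < s}) :
    quasiconvexEnvelope uS uR μ < s := by
  rw [quasiconvexEnvelope_eq_neg, neg_lt]
  refine lt_quasiconcaveEnvelope_of_mem_convexHull (uS := -uS) huS.neg huR ?_
  simpa only [upperValue_neg, neg_lt_neg_iff] using hμ

/-- A value above the quasiconvex envelope exceeds a value that is available at all beliefs of
some finite splitting. -/
theorem exists_mem_convexHull_of_quasiconvexEnvelope_lt (huS : Continuous uS)
    (huR : ∀ ω, Continuous (uR ω)) {μ : Ω → ℝ} (hμ : μ ∈ stdSimplex ℝ Ω) {s : ℝ}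
    (hs : quasiconvexEnvelope uS uR μ < s) :
    ∃ v < s, μ ∈ convexHull ℝ {ν ∈ stdSimplex ℝ Ω | v ∈ valueCorr uS uR ν} := by
  rw [quasiconvexEnvelope_eq_neg, neg_lt] at hs
  obtain ⟨v, hv, h⟩ :=
    exists_mem_convexHull_of_lt_quasiconcaveEnvelope (uS := -uS) huS.neg huR hμ hs
  refine ⟨-v, neg_lt.1 hv, ?_⟩
  simpa only [valueCorr_neg, Set.mem_neg] using h

variable [MeasurableSpace A] [BorelSpace A]

/-- Were the envelope larger, some value above `valueCT` would be available throughout a splitting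
of `p`. -/
theorem quasiconcaveEnvelope_le_valueCT (huS : Continuous uS) (huR : ∀ ω, Continuous (uR ω))
    (hp : p ∈ stdSimplex ℝ Ω) : quasiconcaveEnvelope uS uR p ≤ valueCT uS uR p := by
  by_contra! h
  obtain ⟨v, hv, hmem⟩ := exists_mem_convexHull_of_lt_quasiconcaveEnvelope huS huR hp h
  obtain ⟨τ, V, hf, hV⟩ := exists_ctFeasible_of_mem_convexHull huS huR hmem
  exact absurd (le_valueCT huS hf) (not_le.2 (hV ▸ hv))

theorem exists_ctFeasible (huS : Continuous uS) (huR : ∀ ω, Continuous (uR ω))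
    (hp : p ∈ stdSimplex ℝ Ω) : ∃ τ V, CTFeasible uS uR p τ V := by
  obtain ⟨τ, V, h, -⟩ := exists_ctFeasible_of_mem_convexHull huS huR
    (subset_convexHull ℝ {ν ∈ stdSimplex ℝ Ω | upperValue uS uR p ∈ valueCorr uS uR ν}
      ⟨hp, upperValue_mem_valueCorr huS huR p⟩)
  exact ⟨τ, V, h⟩

theorem valueCT_le_valueMD (huS : Continuous uS) (huR : ∀ ω, Continuous (uR ω))
    (hp : p ∈ stdSimplex ℝ Ω) : valueCT uS uR p ≤ valueMD uS uR p := by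
  obtain ⟨τ, V, h⟩ := exists_ctFeasible huS huR hp
  refine csSup_le ⟨_, τ, V, h, rfl⟩ ?_
  rintro _ ⟨τ', V', h', rfl⟩
  exact le_valueMD huS (h'.mdFeasible huS)

/-- If mediation strictly outperforms cheap talk, then cheap talk is improvable. -/
theorem ctImprovable_of_valueCT_lt_valueMD (huS : Continuous uS) (huR : ∀ ω, Continuous (uR ω))
    (hp : p ∈ stdSimplex ℝ Ω) (hlt : valueCT uS uR p < valueMD uS uR p) :
    CTImprovable uS uR p := by
  set s := valueCT uS uR p with hs
  obtain ⟨τ₀, V₀, h₀⟩ := exists_ctFeasible huS huR hp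
  obtain ⟨_, ⟨τ, V, hf, rfl⟩, hsv⟩ :=
    exists_lt_of_lt_csSup (s := {x | ∃ τ V, MDFeasible uS uR p τ V ∧
      x = ∫ μ, V μ ∂(τ : Measure (Belief Ω))}) ⟨_, τ₀, V₀, h₀.mdFeasible huS, rfl⟩ hlt
  set v := ∫ μ, V μ ∂(τ : Measure (Belief Ω))
  obtain ⟨ι, _, w, q, hw0, hw1, hq, hsum⟩ :=
    mem_convexHull_iff_exists_fintype.1 (hf.mem_convexHull huS huR)
  choose hqs a ha hqa using hq
  have hsum1 : ∑ i, w i • (q i).1 = p := by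
    simpa [Prod.fst_sum] using congrArg Prod.fst hsum
  have hsum2 : ∑ i, w i • (uS (a i) • (q i).1) = v • p := by
    simpa [Prod.snd_sum, hqa] using congrArg Prod.snd hsum
  have hval : ∀ i, uS (a i) ∈ Icc (lowerValue uS uR (q i).1) (upperValue uS uR (q i).1) :=
    fun i => valueCorr_eq_Icc huS huR (q i).1 ▸
      subset_convexHull ℝ _ (mem_image_of_mem _ (ha i))
  -- Excess and shortfall relative to `s`; the two weighted sums of beliefs differ by `(v - s) • p`.
  let g₁ : ι → ℝ := fun i => w i * (uS (a i) - s)⁺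
  let g₂ : ι → ℝ := fun i => w i * (uS (a i) - s)⁻
  have hg₁ : ∀ i, 0 ≤ g₁ i := fun i => mul_nonneg (hw0 i) (posPart_nonneg _)
  have hg₂ : ∀ i, 0 ≤ g₂ i := fun i => mul_nonneg (hw0 i) (negPart_nonneg _)
  have hdiff : ∑ i, g₁ i • (q i).1 - ∑ i, g₂ i • (q i).1 = (v - s) • p := by
    rw [sub_smul, ← hsum2, ← hsum1, Finset.smul_sum, ← Finset.sum_sub_distrib,
      ← Finset.sum_sub_distrib]
    refine Finset.sum_congr rfl fun i _ => ?_
    rw [← sub_smul, ← mul_sub, posPart_sub_negPart]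
    module
  have hdiff1 : ∑ i, g₁ i - ∑ i, g₂ i = v - s := by
    rw [← sum_smul_apply_sum hqs g₁, ← sum_smul_apply_sum hqs g₂, ← Finset.sum_sub_distrib]
    simp only [← Pi.sub_apply, hdiff]
    simp only [Pi.smul_apply, smul_eq_mul, ← Finset.mul_sum, hp.2, mul_one]
  have hG₂ : 0 ≤ ∑ i, g₂ i := Finset.sum_nonneg fun i _ => hg₂ i
  have hG₁ : 0 < ∑ i, g₁ i := by linarith
  have hmem₁ := inv_sum_smul_mem_convexHull (x := fun i => (q i).1)
    (S := {ν ∈ stdSimplex ℝ Ω | s < upperValue uS uR ν}) hg₁ hG₁ fun i hi => by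
      refine ⟨hqs i, lt_of_lt_of_le ?_ (hval i).2⟩
      by_contra! hle
      exact hi (by simp only [g₁, posPart_eq_zero.2 (sub_nonpos.2 hle), mul_zero])
  have henv := lt_quasiconcaveEnvelope_of_mem_convexHull huS huR hmem₁
  -- With no shortfall, the normalized excess is `p` itself, and the envelope at `p` would exceed
  -- the cheap talk value.
  rcases hG₂.eq_or_lt with hzero | hpos
  · refine absurd (quasiconcaveEnvelope_le_valueCT huS huR hp) (not_le.2 ?_)
    have hz : ∀ i, g₂ i = 0 := fun i =>
      (Finset.sum_eq_zero_iff_of_nonneg fun i _ => hg₂ i).1 hzero.symm i (Finset.mem_univ i)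
    have hG : ∑ i, g₁ i = v - s := by linarith
    have hpeq : (∑ i, g₁ i)⁻¹ • ∑ i, g₁ i • (q i).1 = p := by
      rw [inv_smul_eq_iff₀ hG₁.ne', hG, ← hdiff]
      simp only [hz, zero_smul, Finset.sum_const_zero, sub_zero]
    rwa [hpeq] at henv
  · have hmem₂ := inv_sum_smul_mem_convexHull (x := fun i => (q i).1)
      (S := {ν ∈ stdSimplex ℝ Ω | lowerValue uS uR ν < s}) hg₂ hpos fun i hi => by
        refine ⟨hqs i, lt_of_le_of_lt (hval i).1 ?_⟩
        by_contra! hle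
        exact hi (by simp only [g₂, negPart_eq_zero.2 (sub_nonneg.2 hle), mul_zero])
    -- The ratio is below one because the total excess is larger by `v - s > 0`.
    refine ⟨_, ?_, (∑ i, g₂ i) / ∑ i, g₁ i, ⟨by positivity, ?_⟩, ?_,
      quasiconvexEnvelope_lt_of_mem_convexHull huS huR hmem₂⟩
    · exact convexHull_min (fun ν hν => hν.1) (convex_stdSimplex ℝ Ω) hmem₂
    · rw [div_lt_one hG₁]
      linarith
    · convert henv using 1
      congr 1
      have h1 : ∑ i, g₁ i • (q i).1 = ∑ i, g₂ i • (q i).1 + (v - s) • p := by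
        rw [← hdiff, add_sub_cancel]
      have h2 : 1 - (∑ i, g₂ i) / ∑ i, g₁ i = (∑ i, g₁ i)⁻¹ * (v - s) := by
        rw [← hdiff1]
        field_simp
      rw [h1, smul_add, smul_smul, smul_smul, h2, div_eq_mul_inv, mul_right_comm,
        mul_inv_cancel₀ hpos.ne', one_mul]

/-- If cheap talk is locally improvable, then mediation strictly outperforms cheap talk. -/
theorem valueCT_lt_valueMD_of_ctLocallyImprovable (huS : Continuous uS)
    (huR : ∀ ω, Continuous (uR ω)) (hp : p ∈ stdSimplex ℝ Ω)
    (h : CTLocallyImprovable uS uR p) : valueCT uS uR p < valueMD uS uR p := by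
  obtain ⟨μ, hμ, r, ⟨hr0, hr1⟩, hup, hlow⟩ := h
  set s := valueCT uS uR p
  have hμs : μ ∈ stdSimplex ℝ Ω := hμ.1
  have hμ's : r • μ + (1 - r) • p ∈ stdSimplex ℝ Ω :=
    convex_stdSimplex ℝ Ω hμs hp hr0 (by linarith) (by ring)
  obtain ⟨v, hv, hvmem⟩ := exists_mem_convexHull_of_lt_quasiconcaveEnvelope huS huR hμ's hup
  obtain ⟨u, hu, humem⟩ := exists_mem_convexHull_of_quasiconvexEnvelope_lt huS huR hμs hlow
  obtain ⟨ι, _, m, c, x, hm, hx, hxs, hmp, hcμ⟩ := exists_splitting_of_mem_cheapTalkHull hμ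
  have hm1 : ∑ i, m i = 1 := by rw [← sum_smul_apply_sum hx m, hmp, hp.2]
  have hc1 : ∑ i, c i = 1 := by rw [← sum_smul_apply_sum hx c, hcμ, hμs.2]
  -- Masses per unit of `ε`: the gain `a(v-s)(rμ+(1-r)p)` less the loss `b(s-u)μ` equals `(1-r)p`.
  obtain ⟨a, ha⟩ : ∃ a, a = 1 / (v - s) := ⟨_, rfl⟩
  obtain ⟨b, hb⟩ : ∃ b, b = r / (s - u) := ⟨_, rfl⟩
  have ha0 : 0 ≤ a := ha ▸ div_nonneg zero_le_one (sub_pos.2 hv).le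
  have hb0 : 0 ≤ b := hb ▸ div_nonneg hr0 (sub_pos.2 hu).le
  have ha' : a * (v - s) = 1 := by rw [ha, div_mul_cancel₀ _ (sub_pos.2 hv).ne']
  have hb' : b * (s - u) = r := by rw [hb, div_mul_cancel₀ _ (sub_pos.2 hu).ne']
  -- These coefficients express the total added belief mass `a(rμ+(1-r)p) + bμ` through the `x i`.
  -- Some may be negative, but for small `ε` the weights `m i - ε * z i` remain positive.
  let z : ι → ℝ := fun i => (a * r + b) * c i + a * (1 - r) * m i
  obtain ⟨ε, hεz, hε⟩ : ∃ ε : ℝ, (∀ i, ε * z i < m i) ∧ 0 < ε := by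
    have h1 : ∀ᶠ ε in nhdsWithin (0 : ℝ) (Ioi 0), ∀ i, ε * z i < m i := by
      refine Filter.eventually_all.2 fun i => ?_
      have : Filter.Tendsto (fun ε : ℝ => ε * z i) (nhds 0) (nhds (0 * z i)) :=
        (continuous_mul_const (z i)).tendsto 0
      rw [zero_mul] at this
      exact (this.eventually (gt_mem_nhds (hm i))).filter_mono nhdsWithin_le_nhds
    obtain ⟨ε, h2, h3⟩ := (h1.and self_mem_nhdsWithin).exists
    exact ⟨ε, h2, h3⟩
  have hzsum : ∑ i, (m i - ε * z i) • x i =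
      p - ε • ((a * r + b) • μ + (a * (1 - r)) • p) := by
    rw [← hcμ, ← hmp]
    simp only [Finset.smul_sum, ← Finset.sum_add_distrib, ← Finset.sum_sub_distrib]
    refine Finset.sum_congr rfl fun i _ => ?_
    simp only [z]
    module
  have hzsum1 : ∑ i, (m i - ε * z i) = 1 - ε * (a + b) := by
    simp only [z, Finset.sum_sub_distrib, ← Finset.mul_sum, Finset.sum_add_distrib, hm1, hc1]
    ring
  have hmem := (convex_convexHull ℝ (scaledGraph uS uR)).sum_mem (t := Finset.univ)
    (w := Sum.elim (fun i => m i - ε * z i) fun j : Bool => if j then ε * a else ε * b)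
    (z := Sum.elim (fun i => (x i, s • x i)) fun j : Bool =>
      if j then (r • μ + (1 - r) • p, v • (r • μ + (1 - r) • p)) else (μ, u • μ))
    (by
      rintro (i | (_ | _)) -
      · exact (sub_pos.2 (hεz i)).le
      · simpa using mul_nonneg hε.le hb0
      · simpa using mul_nonneg hε.le ha0)
    (by
      simp only [Fintype.sum_sum_type, Sum.elim_inl, Sum.elim_inr, Fintype.sum_bool, hzsum1]
      simp only [if_true, Bool.false_eq_true, if_false]
      ring)
    (by
      rintro (i | (_ | _)) -
      · exact mk_smul_mem_convexHull_scaledGraph (subset_convexHull ℝ _ ⟨hx i, hxs i⟩)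
      · simpa using mk_smul_mem_convexHull_scaledGraph humem
      · simpa using mk_smul_mem_convexHull_scaledGraph hvmem)
  have hfinal : (p, (s + ε * (1 - r)) • p) ∈ convexHull ℝ (scaledGraph uS uR) := by
    convert hmem using 1
    simp only [Fintype.sum_sum_type, Sum.elim_inl, Sum.elim_inr, Fintype.sum_bool, if_true,
      Bool.false_eq_true, if_false]
    refine Prod.ext ?_ ?_
    · simp only [Prod.fst_add, Prod.fst_sum, Prod.smul_fst, hzsum]
      module
    · simp only [Prod.snd_add, Prod.snd_sum, Prod.smul_snd, smul_comm _ s, ← Finset.smul_sum,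
        hzsum]
      funext ω
      simp only [Pi.add_apply, Pi.sub_apply, Pi.smul_apply, smul_eq_mul]
      linear_combination -ε * (r * μ ω + (1 - r) * p ω) * ha' + ε * μ ω * hb'
  obtain ⟨τ, V, hf, hV⟩ := exists_mdFeasible_of_mem_convexHull huS huR hp.2 hfinal
  have := le_valueMD huS hf
  rw [hV] at this
  have : 0 < ε * (1 - r) := mul_pos hε (by linarith)
  linarith

end Values

/-! ### Degenerate mechanisms yield only cheap talk distributions -/

section NotRandom

variable {Ω : Type*} {M : Type*} [MeasurableSpace M] {σ : Ω → ProbabilityMeasure M}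

/-- Every measurable function to a countably separated space is almost surely constant under a
degenerate law. -/
theorem exists_ae_eq_const_of_not_isRandom {Y : Type*} [MeasurableSpace Y] [Nonempty Y]
    [MeasurableSpace.CountablySeparated Y] (hσ : ¬ IsRandom σ) {β : M → Y} (hβ : Measurable β)
    (ω : Ω) : ∃ b, ∀ᵐ m ∂(σ ω : Measure M), β m = b := by
  refine Filter.exists_eventuallyEq_const_of_forall_separating MeasurableSet fun U hU => ?_
  by_cases h : (σ ω : Measure M) (β ⁻¹' U) = 0
  · exact Or.inr (measure_eq_zero_iff_ae_notMem.1 h)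
  · refine Or.inl ((prob_compl_eq_zero_iff (hβ hU)).2 ?_)
    by_contra h1
    exact hσ ⟨ω, _, hβ hU, pos_iff_ne_zero.2 h, lt_of_le_of_ne prob_le_one h1⟩

variable [Fintype Ω] {p : Ω → ℝ} {A : Type*} [MeasurableSpace A] {uS : A → ℝ} {uR : Ω → A → ℝ}

/-- Bayes' rule for expectations of functions of the belief. -/
theorem IsCommunicationEquilibrium.mul_integral_belief {α : Kernel M A} {β : M → Belief Ω}
    (h : IsCommunicationEquilibrium uS uR p σ α β) {τ : ProbabilityMeasure (Belief Ω)}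
    (hτ : Induces p σ β τ) (ω : Ω) (hp : 0 ≤ p ω) {g : Belief Ω → ℝ} (hg : Measurable g) :
    p ω * ∫ m, g (β m) ∂(σ ω : Measure M) =
      ∫ μ, g μ * μ.1 ω ∂(τ : Measure (Belief Ω)) := by
  have h1 : Measurable fun m => ENNReal.ofReal ((β m).1 ω) :=
    ((measurable_belief_apply ω).comp h.measurable_belief).ennreal_ofReal
  have h2 := integral_smul_measure (μ := (σ ω : Measure M)) (fun m => g (β m))
    (ENNReal.ofReal (p ω))
  rw [ENNReal.toReal_ofReal hp, smul_eq_mul, h.bayes ω,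
    integral_withDensity_eq_integral_toReal_smul h1 (ae_of_all _ fun _ => ENNReal.ofReal_lt_top)]
    at h2
  have h3 : Measurable fun μ : Belief Ω => g μ * μ.1 ω := hg.mul (measurable_belief_apply ω)
  rw [← h2, ← hτ, integral_map h.measurable_belief.aemeasurable h3.aestronglyMeasurable]
  refine integral_congr_ae (ae_of_all _ fun m => ?_)
  simp only [smul_eq_mul]
  rw [ENNReal.toReal_ofReal ((β m).2.1 ω), mul_comm]

/-- A feasible distribution under mediation whose value exceeds that of cheap talk is only induced
by random mechanisms. -/
theorem isRandom_of_induces [MetricSpace A] [CompactSpace A] (huS : Continuous uS) (hpos : ∀ ω, 0 < p ω)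
    {τ : ProbabilityMeasure (Belief Ω)} {V : Belief Ω → ℝ} (hf : MDFeasible uS uR p τ V)
    (hlt : valueCT uS uR p < ∫ μ, V μ ∂(τ : Measure (Belief Ω))) {α : Kernel M A}
    {β : M → Belief Ω} (h : IsCommunicationEquilibrium uS uR p σ α β) (hτ : Induces p σ β τ) :
    IsRandom σ := by
  by_contra hσ
  obtain ⟨hV, hBP, hcov⟩ := hf
  set v := ∫ μ, V μ ∂(τ : Measure (Belief Ω)) with hv
  have : Nonempty (Belief Ω) := nonempty_of_isProbabilityMeasure (τ : Measure (Belief Ω))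
  choose b hb using exists_ae_eq_const_of_not_isRandom hσ h.measurable_belief
  -- By zero covariance the mean of `V` conditional on each state is `v`, and in state `ω` the
  -- belief is almost surely `b ω`.
  have hVb : ∀ ω, V (b ω) = v := by
    intro ω
    have h1 := h.mul_integral_belief hτ ω (hpos ω).le hV.1
    rw [(covariance_eq_zero_iff huS hV hBP ω).1 (hcov ω), ← hv,
      integral_congr_ae (g := fun _ => V (b ω)) ((hb ω).mono fun m hm => by simp only [hm]),
      integral_const, probReal_univ, one_smul, mul_comm] at h1
    exact mul_right_cancel₀ (hpos ω).ne' h1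
  have hfin : (range b).Finite := finite_range b
  have hsupp : (τ : Measure (Belief Ω)).support ⊆ range b := by
    refine Measure.support_subset_of_isClosed hfin.isClosed ?_
    rw [mem_ae_iff, ← hτ, Measure.map_apply h.measurable_belief hfin.measurableSet.compl,
      messageLaw, Measure.finsetSum_apply]
    refine Finset.sum_eq_zero fun ω _ => ?_
    have h0 : (σ ω : Measure M) (β ⁻¹' (range b)ᶜ) = 0 := by
      refine measure_eq_zero_iff_ae_notMem.2 ((hb ω).mono fun m hm => ?_)
      simp [hm]
    rw [Measure.smul_apply, h0, smul_zero]
  have hct : CTFeasible uS uR p τ V := ⟨hV, hBP, v, fun μ hμ => by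
    obtain ⟨ω, rfl⟩ := hsupp hμ
    exact hVb ω⟩
  exact absurd (le_valueCT huS hct) (not_le.2 hlt)

end NotRandom

/-! ### The direct mechanism that announces beliefs -/

section DirectMechanism

variable {Ω : Type*} [Fintype Ω] {p : Ω → ℝ}

/-- The law of the belief conditional on the state `ω`. -/
noncomputable def conditionalLaw (p : Ω → ℝ) (τ : ProbabilityMeasure (Belief Ω)) (ω : Ω) :
    Measure (Belief Ω) :=
  (τ : Measure (Belief Ω)).withDensity fun μ => ENNReal.ofReal (μ.1 ω / p ω)

theorem measurable_density (p : Ω → ℝ) (ω : Ω) :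
    Measurable fun μ : Belief Ω => ENNReal.ofReal (μ.1 ω / p ω) :=
  ((measurable_belief_apply ω).div_const _).ennreal_ofReal

theorem isProbabilityMeasure_conditionalLaw (hpos : ∀ ω, 0 < p ω)
    {τ : ProbabilityMeasure (Belief Ω)} (hτ : BayesPlausible p τ) (ω : Ω) :
    IsProbabilityMeasure (conditionalLaw p τ ω) := by
  constructor
  have hint : Integrable (fun μ : Belief Ω => μ.1 ω / p ω) (τ : Measure (Belief Ω)) :=
    (memLp_one_iff_integrable.1 (memLp_belief_apply τ ω 1)).div_const _
  rw [conditionalLaw, withDensity_apply _ MeasurableSet.univ, Measure.restrict_univ,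
    ← ofReal_integral_eq_lintegral_ofReal hint
      (ae_of_all _ fun μ => div_nonneg (μ.2.1 ω) (hpos ω).le),
    integral_div, hτ ω, div_self (hpos ω).ne', ENNReal.ofReal_one]

theorem smul_conditionalLaw (hpos : ∀ ω, 0 < p ω) (τ : ProbabilityMeasure (Belief Ω)) (ω : Ω) :
    ENNReal.ofReal (p ω) • conditionalLaw p τ ω =
      (τ : Measure (Belief Ω)).withDensity fun μ => ENNReal.ofReal (μ.1 ω) := by
  rw [conditionalLaw, ← withDensity_smul _ (measurable_density p ω)]
  congr 1
  funext μ
  rw [Pi.smul_apply, smul_eq_mul, ← ENNReal.ofReal_mul (hpos ω).le,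
    mul_div_cancel₀ _ (hpos ω).ne']

theorem sum_smul_conditionalLaw (hpos : ∀ ω, 0 < p ω) (τ : ProbabilityMeasure (Belief Ω)) :
    ∑ ω, ENNReal.ofReal (p ω) • conditionalLaw p τ ω = (τ : Measure (Belief Ω)) := by
  ext s hs
  rw [Measure.finsetSum_apply]
  simp only [smul_conditionalLaw hpos, withDensity_apply _ hs]
  rw [← lintegral_finsetSum _ fun ω _ => (measurable_belief_apply ω).ennreal_ofReal]
  have : ∀ μ : Belief Ω, ∑ ω, ENNReal.ofReal (μ.1 ω) = 1 := fun μ => by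
    rw [← ENNReal.ofReal_sum_of_nonneg fun ω _ => μ.2.1 ω, μ.2.2, ENNReal.ofReal_one]
  simp only [this, lintegral_one, Measure.restrict_apply_univ]

theorem integral_conditionalLaw (hpos : ∀ ω, 0 < p ω) (τ : ProbabilityMeasure (Belief Ω)) (ω : Ω)
    (g : Belief Ω → ℝ) : ∫ μ, g μ ∂(conditionalLaw p τ ω) =
      (∫ μ, g μ * μ.1 ω ∂(τ : Measure (Belief Ω))) / p ω := by
  rw [conditionalLaw, integral_withDensity_eq_integral_toReal_smul (measurable_density p ω)
    (ae_of_all _ fun _ => ENNReal.ofReal_lt_top), ← integral_div]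
  refine integral_congr_ae (ae_of_all _ fun μ => ?_)
  simp only [smul_eq_mul]
  rw [ENNReal.toReal_ofReal (div_nonneg (μ.2.1 ω) (hpos ω).le)]
  ring

variable {A : Type*} [MetricSpace A] [CompactSpace A] [Nonempty A] [MeasurableSpace A]
  [BorelSpace A] {uS : A → ℝ} {uR : Ω → A → ℝ}

/-- Every measurable selection of values is generated by a measurable choice of mixed best
responses. -/
theorem IsSelection.exists_kernel (huS : Continuous uS) (huR : ∀ ω, Continuous (uR ω))
    {V : Belief Ω → ℝ} (hV : IsSelection uS uR V) :
    ∃ α : Kernel (Belief Ω) A, IsMarkovKernel α ∧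
      (∀ μ, ∀ᵐ a ∂(α μ), a ∈ bestResponses uR μ.1) ∧ ∀ μ, ∫ a, uS a ∂(α μ) = V μ := by
  obtain ⟨f, hf, hfm, hfu⟩ := exists_measurable_bestResponse_eq_upperValue huS huR
  obtain ⟨g, hg, hgm, hgl⟩ := exists_measurable_bestResponse_eq_lowerValue huS huR
  -- The weight on the sender's favourite best response. If the two extreme payoffs coincide, the
  -- quotient is `0 / 0 = 0`, which is harmless as `V` then equals both.
  let t : Belief Ω → ℝ := fun μ => (V μ - uS (g μ)) / (uS (f μ) - uS (g μ))
  have hVm : ∀ μ, uS (g μ) ≤ V μ ∧ V μ ≤ uS (f μ) := fun μ => by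
    have : V μ ∈ valueCorr uS uR μ.1 := hV.2 μ
    rwa [valueCorr_eq_Icc huS huR, ← hgl, ← hfu] at this
  have ht0 : ∀ μ, 0 ≤ t μ := fun μ =>
    div_nonneg (sub_nonneg.2 (hVm μ).1) (sub_nonneg.2 ((hVm μ).1.trans (hVm μ).2))
  have ht1 : ∀ μ, 0 ≤ 1 - t μ := fun μ => sub_nonneg.2
    (div_le_one_of_le₀ (sub_le_sub_right (hVm μ).2 _)
      (sub_nonneg.2 ((hVm μ).1.trans (hVm μ).2)))
  have htV : ∀ μ, t μ * uS (f μ) + (1 - t μ) * uS (g μ) = V μ := by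
    intro μ
    have h1 : t μ * (uS (f μ) - uS (g μ)) = V μ - uS (g μ) := by
      refine div_mul_cancel_of_imp fun h => ?_
      linarith [(hVm μ).1, (hVm μ).2]
    linarith
  have htm : Measurable t := by
    have h1 := huS.measurable.comp hf
    have h2 := huS.measurable.comp hg
    exact (hV.1.sub h2).div (h1.sub h2)
  let κ : Belief Ω → Measure A := fun μ => ENNReal.ofReal (t μ) • Measure.dirac (f μ) +
    ENNReal.ofReal (1 - t μ) • Measure.dirac (g μ)
  have hκ : Measurable κ := by
    refine Measure.measurable_of_measurable_coe _ fun s hs => ?_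
    simp only [κ, Measure.add_apply, Measure.smul_apply, smul_eq_mul, Measure.dirac_apply' _ hs]
    exact (htm.ennreal_ofReal.mul ((measurable_one.indicator hs).comp hf)).add
      ((htm.const_sub 1).ennreal_ofReal.mul ((measurable_one.indicator hs).comp hg))
  refine ⟨⟨κ, hκ⟩, ⟨fun μ => ⟨?_⟩⟩, fun μ => ?_, fun μ => ?_⟩
  · change κ μ univ = 1
    simp only [κ, Measure.add_apply, Measure.smul_apply, measure_univ, smul_eq_mul, mul_one]
    rw [← ENNReal.ofReal_add (ht0 μ) (ht1 μ), add_sub_cancel, ENNReal.ofReal_one]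
  · change ∀ᵐ a ∂(κ μ), a ∈ bestResponses uR μ.1
    have hms : MeasurableSet (bestResponses uR μ.1) :=
      (isCompact_bestResponses huR μ.1).isClosed.measurableSet
    exact ae_add_measure_iff.2
      ⟨Measure.ae_smul_measure ((ae_dirac_iff hms).2 (hfm μ)) _,
        Measure.ae_smul_measure ((ae_dirac_iff hms).2 (hgm μ)) _⟩
  · change ∫ a, uS a ∂(κ μ) = V μ
    have hi : ∀ (a : A) (c : ℝ), Integrable uS (ENNReal.ofReal c • Measure.dirac a) := fun a c =>
      (integrable_dirac enorm_lt_top).smul_measure ENNReal.ofReal_ne_top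
    simp only [κ]
    rw [integral_add_measure (hi _ _) (hi _ _), integral_smul_measure, integral_smul_measure,
      integral_dirac, integral_dirac, ENNReal.toReal_ofReal (ht0 μ),
      ENNReal.toReal_ofReal (ht1 μ), smul_eq_mul, smul_eq_mul, htV]

/-- A feasible pair of the mediation program is implemented by the mechanism that recommends
beliefs. -/
theorem MDFeasible.exists_mechanism (huS : Continuous uS) (huR : ∀ ω, Continuous (uR ω))
    (hpos : ∀ ω, 0 < p ω) {τ : ProbabilityMeasure (Belief Ω)} {V : Belief Ω → ℝ}
    (hf : MDFeasible uS uR p τ V) :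
    ∃ (σ : Ω → ProbabilityMeasure (Belief Ω)) (α : Kernel (Belief Ω) A),
      IsCommunicationEquilibrium uS uR p σ α id ∧ Induces p σ id τ ∧
        senderPayoff uS p σ α = ∫ μ, V μ ∂(τ : Measure (Belief Ω)) := by
  obtain ⟨hV, hBP, hcov⟩ := hf
  obtain ⟨α, hα, hbr, hαV⟩ := hV.exists_kernel huS huR
  let σ : Ω → ProbabilityMeasure (Belief Ω) := fun ω =>
    ⟨conditionalLaw p τ ω, isProbabilityMeasure_conditionalLaw hpos hBP ω⟩
  have hlaw : messageLaw p σ = (τ : Measure (Belief Ω)) := sum_smul_conditionalLaw hpos τ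
  -- Zero covariance makes every report worth the same, so honesty holds with equality.
  have hval : ∀ ω, ∫ μ, V μ ∂(σ ω : Measure (Belief Ω)) =
      ∫ μ, V μ ∂(τ : Measure (Belief Ω)) := by
    intro ω
    have := integral_conditionalLaw hpos τ ω V
    rw [(covariance_eq_zero_iff huS hV hBP ω).1 (hcov ω),
      mul_div_cancel_right₀ _ (hpos ω).ne'] at this
    exact this
  refine ⟨σ, α, ⟨hα, measurable_id, fun ω => ?_, ae_of_all _ hbr, fun ω ω' => ?_⟩, ?_, ?_⟩
  · rw [hlaw]
    exact smul_conditionalLaw hpos τ ω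
  · simp only [hαV, hval, le_refl]
  · rw [Induces, hlaw, Measure.map_id]
  · simp only [senderPayoff, hαV, hlaw]

end DirectMechanism

end Mediation

open Mediation
theorem corollary5 {Ω : Type*} [Fintype Ω] {A : Type*} [MetricSpace A] [CompactSpace A]
    [Nonempty A] [MeasurableSpace A] [BorelSpace A]
    (uS : A → ℝ) (huS : Continuous uS) (uR : Ω → A → ℝ) (huR : ∀ ω, Continuous (uR ω))
    (p : Ω → ℝ) (hp : p ∈ stdSimplex ℝ Ω) (hpos : ∀ ω, 0 < p ω) :
    (CTLocallyImprovable uS uR p →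
      valueCT uS uR p < valueMD uS uR p ∧
      ∀ τ : ProbabilityMeasure (Belief Ω), IsOptimalMD uS uR p τ →
        InducedByRandomMechanism uS uR p τ (valueMD uS uR p) ∧
        ∀ (M : Type*) [MeasurableSpace M] (σ : Ω → ProbabilityMeasure M) (α : Kernel M A)
          (β : M → Belief Ω), IsCommunicationEquilibrium uS uR p σ α β → Induces p σ β τ →
            IsRandom σ) ∧
    (¬ CTImprovable uS uR p → valueMD uS uR p = valueCT uS uR p) ∧
    (FullDimensional uS uR p →
      (valueCT uS uR p < valueMD uS uR p ↔ CTImprovable uS uR p)) := by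
  refine ⟨fun h => ?_, fun h => ?_, fun hfull => ⟨?_, fun h => ?_⟩⟩
  · have hlt := valueCT_lt_valueMD_of_ctLocallyImprovable huS huR hp h
    refine ⟨hlt, fun τ ⟨V, hf, hV⟩ => ⟨?_, fun M _ σ α β heq hτ => ?_⟩⟩
    · obtain ⟨σ, α, heq, hτ, hpay⟩ := hf.exists_mechanism huS huR hpos
      exact ⟨Belief Ω, inferInstance, σ, α, id, heq, hτ, hpay.trans hV,
        isRandom_of_induces huS hpos hf (hV ▸ hlt) heq hτ⟩
    · exact isRandom_of_induces huS hpos hf (hV ▸ hlt) heq hτ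
  · refine le_antisymm ?_ (valueCT_le_valueMD huS huR hp)
    by_contra! hlt
    exact h (ctImprovable_of_valueCT_lt_valueMD huS huR hp hlt)
  · exact ctImprovable_of_valueCT_lt_valueMD huS huR hp
  · refine valueCT_lt_valueMD_of_ctLocallyImprovable huS huR hp ?_
    -- When `H*` is the whole simplex, local improvability and improvability coincide.
    rw [CTLocallyImprovable, hfull]
    exact h
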